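/- Let $\Sigma$ be a connected smooth surface and $M$ a connected smooth $D$-dimensional manifold, let $\psi\colon\Sigma\to M$ be smooth, and let $\gamma$, $g$ be smooth Riemannian metrics on $\Sigma$ and $M$. Put $E\varphi=\operatorname{tr}_h(\nabla^\psi\circ\nabla^\psi\varphi)$ for sections $\varphi$ of $\psi^*TM$, i.e. $(E\varphi)_a=g_{ab}(\psi)\gamma^{\alpha\beta}(\nabla^\psi\nabla^\psi\varphi)^b_{\alpha\beta}$, where $\nabla^\psi$ is the pull-back of the Levi-Civita connection of $g$, combined with the Levi-Civita connection of $\gamma$. For $\lambda>0$ the background $b=(\psi,\gamma,g)$ is rescaled to $b_\lambda=(\psi,\lambda^{-2}\gamma,g)$. Let $\mathcal O\subset\Sigma$ be a convex geodesic neighbourhood: an open set any two points of which are joined by a unique minimising geodesic, which lies in $\mathcal O$ and depends smoothly on its endpoints. Let $\sigma(x,x')$ be half the squared geodesic distance of $\gamma$. The Hadamard coefficients of $E$ on $\mathcal O$ for $b$ are smooth bitensors $V_n^{bc}(x,x')$ on $\mathcal O\times\mathcal O$ (sections of $\psi^*TM\boxtimes\psi^*TM$), $n\ge 0$, with $V_0^{bc}(x,x)=g^{bc}(\psi(x))$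 and, with all derivatives acting on $x$, $$2g_{ab}\gamma^{\alpha\beta}(\nabla^\psi V_0)^{bc}{}_{\alpha}(\mathrm d\sigma)_\beta+g_{ab}V_0^{bc}(\Delta_\gamma\sigma-2)=0,$$ $$E(V_{n-1})^c{}_a+2n\,g_{ab}\gamma^{\alpha\beta}(\nabla^\psi V_n)^{bc}{}_{\alpha}(\mathrm d\sigma)_\beta+n\,g_{ab}V_n^{bc}\big(\Delta_\gamma\sigma+2(n-1)\big)=0\qquad(n\ge1).$$ The Hadamard parametrix is $H^{bc}=V^{bc}\log(\sigma/\ell^2)$ off the diagonal, where $\ell>0$ is a fixed length and $V=\sum_n V_n\sigma^n$. The sum is a formal power series. A sum of it on $\mathcal O$ is any smooth bitensor $V$ with $V-\sum_{n<N}V_n\sigma^n=O(\sigma^N)$ at the diagonal for all $N$. Let $\sigma_\lambda$, $V_{\lambda,n}$ and $H_\lambda$ be the corresponding objects for $b_\lambda$, with the same $\ell$. Write $[T](x)=T(x,x)$ for the coinciding-point limit. Suppose that $(V_n)$ are Hadamard coefficients for $b$ on $\mathcal O$. Then: 1. $(\lambda^{2n}V_n)$ are Hadamard coefficients for $b_\lambda$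 on $\mathcal O$, and they are the only ones (in particular, for $\lambda=1$, the $V_n$ are determined by the background). 2. $H_\lambda-H=-2\log(\lambda)\,V$ as formal series: for every $N$ and all $x\ne x'$ in $\mathcal O$, $$\sum_{n<N}V_{\lambda,n}\sigma_\lambda^n\log\frac{\sigma_\lambda}{\ell^2}-\sum_{n<N}V_n\sigma^n\log\frac{\sigma}{\ell^2}=-2\log(\lambda)\sum_{n<N}V_n\sigma^n.$$ 3. Every sum $V$ of the series for $b$ satisfies $[V]^{bc}=g^{bc}\circ\psi$ on $\mathcal O$ and is also a sum of the series for $b_\lambda$. If both parametrices are formed with it, $H_\lambda-H=-2\log(\lambda)\,V$ exactly, at all $x\neq x'$ in $\mathcal O$. If $H_\lambda$ is formed with another sum $V_\lambda$ of the series for $b_\lambda$, then $[V_\lambda]^{bc}=g^{bc}\circ\psi$ also holds, and $H_\lambda-H=-2\log(\lambda)\,V+O(\sigma^N)$ at the diagonal for every $N$. 4. Let $P$ be a kernel with $P=H+W_P$ off the diagonal of $\mathcal O\times\mathcal O$, where $W_P$ is a smooth bitensor. Then $P=H_\lambda+W_{P,\lambda}$ off the diagonal, with $W_{P,\lambda}=W_P+2\log(\lambda)V$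 smooth when $H_\lambda$ is formed with the same $V$; it is symmetric if $V$ and $W_P$ are. For every choice of the sums and every smooth $W_{P,\lambda}$ with $P=H_\lambda+W_{P,\lambda}$ off the diagonal, $[W_{P,\lambda}]^{bc}=[W_P]^{bc}+2g^{bc}(\psi)\log\lambda$ on $\mathcal O$. -/

import Mathlib

open Set Filter Topology
open scoped Manifold ContDiff TensorProduct Bundle

noncomputable section

namespace HadamardScaling

/-- The model space `ℝⁿ`. -/
abbrev Eu (n : ℕ) := EuclideanSpace ℝ (Fin n)

/-! ### Riemannian metrics, charts, coordinate expressions -/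

section Metric

variable {n : ℕ} {X : Type*} [TopologicalSpace X] [ChartedSpace (Eu n) X] [IsManifold (𝓡 n) ∞ X]

variable (n X) in
/-- Smooth Riemannian metrics on the `n`-dimensional manifold `X`. -/
abbrev Metric :=
  Bundle.ContMDiffRiemannianMetric (𝓡 n) ∞ (Eu n) (fun x : X => TangentSpace (𝓡 n) x)

set_option synthInstance.maxHeartbeats 400000 in
/-- The metric `r • G` for a constant `r > 0`. -/
def Metric.scale (G : Metric n X) (r : ℝ) (hr : 0 < r) : Metric n X where
  inner x := r • G.inner x
  symm x v w := by
    simp [G.symm x v w]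
  pos x v hv := by
    simpa using mul_pos hr (G.pos x v hv)
  isVonNBounded x := by
    have h := (G.isVonNBounded x).image
      ((Real.sqrt r)⁻¹ • ContinuousLinearMap.id ℝ (TangentSpace (𝓡 n) x))
    refine h.subset fun v hv => ?_
    have hs : Real.sqrt r ≠ 0 := (Real.sqrt_pos.2 hr).ne'
    refine ⟨Real.sqrt r • v, ?_, ?_⟩
    · have h2 : Real.sqrt r * (Real.sqrt r * G.inner x v v) < 1 := by
        rw [← mul_assoc, Real.mul_self_sqrt hr.le]
        simpa using hv
      simpa using h2
    · simp [smul_smul, hs]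
  contMDiff := G.contMDiff.const_smul_section (a := r)

/-- The smooth charts of `X`. -/
abbrev smoothCharts (n : ℕ) (X : Type*) [TopologicalSpace X] [ChartedSpace (Eu n) X] :
    Set (OpenPartialHomeomorph X (Eu n)) :=
  IsManifold.maximalAtlas (𝓡 n) ∞ X

/-- The differential of the chart `χ` at `x`, as a map `T_xX → ℝⁿ`. -/
def chartDiff (χ : OpenPartialHomeomorph X (Eu n)) (x : X) : TangentSpace (𝓡 n) x →L[ℝ] Eu n :=
  mfderiv (𝓡 n) (𝓡 n) χ x

/-- The coordinate covector `dχᵃ` at `x`. -/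
def coordForm (χ : OpenPartialHomeomorph X (Eu n)) (x : X) (a : Fin n) :
    TangentSpace (𝓡 n) x →ₗ[ℝ] ℝ :=
  ((EuclideanSpace.proj a : Eu n →L[ℝ] ℝ) ∘L chartDiff χ x).toLinearMap

/-- The coordinate vector `∂ₐ` at `x`, i.e. the preimage of the `a`-th unit vector of `ℝⁿ` under
the differential of the chart. -/
def coordVec (χ : OpenPartialHomeomorph X (Eu n)) (x : X) (a : Fin n) : TangentSpace (𝓡 n) x :=
  (chartDiff χ x).inverse (EuclideanSpace.single a 1)

/-- The partial derivative `∂ₐ f` at `x` in the chart `χ`. -/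
def pd (χ : OpenPartialHomeomorph X (Eu n)) (a : Fin n) (f : X → ℝ) (x : X) : ℝ :=
  fderiv ℝ (f ∘ χ.symm) (χ x) (EuclideanSpace.single a 1)

/-- The components `G_{ab}` of the metric in a chart. -/
def gram (G : Metric n X) (χ : OpenPartialHomeomorph X (Eu n)) (x : X) :
    Matrix (Fin n) (Fin n) ℝ :=
  Matrix.of fun a b => G.inner x (coordVec χ x a) (coordVec χ x b)

/-- The components `G^{ab}` of the inverse metric in a chart. -/
def gramInv (G : Metric n X) (χ : OpenPartialHomeomorph X (Eu n)) (x : X) :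
    Matrix (Fin n) (Fin n) ℝ :=
  (gram G χ x)⁻¹

/-- The Christoffel symbol `Γᵃ_{bc}` of the Levi-Civita connection in a chart. -/
def christoffel (G : Metric n X) (χ : OpenPartialHomeomorph X (Eu n)) (a b c : Fin n) (x : X) :
    ℝ :=
  (1 / 2) * ∑ d, gramInv G χ x a d *
    (pd χ b (fun y => gram G χ y d c) x + pd χ c (fun y => gram G χ y d b) x
      - pd χ d (fun y => gram G χ y b c) x)

/-- The Laplace-Beltrami operator `Δ f = G^{ab} (∂ₐ∂_b f - Γᵈ_{ab} ∂_d f)` in a chart. -/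
def laplacian (G : Metric n X) (χ : OpenPartialHomeomorph X (Eu n)) (f : X → ℝ) (x : X) : ℝ :=
  ∑ a, ∑ b, gramInv G χ x a b *
    (pd χ a (fun y => pd χ b f y) x - ∑ d, christoffel G χ d a b x * pd χ d f x)

/-- The inverse metric as an element of `T_xX ⊗ T_xX`: the sum `∑ G^{ab} e_a ⊗ e_b` over a basis
of `T_xX`, where `G^{ab}` is the inverse of the Gram matrix. The tensor does not depend on the
basis; the standard basis of `T_xX` (which Mathlib models as `ℝⁿ`) is used. -/
def inverseMetric (G : Metric n X) (x : X) :
    TangentSpace (𝓡 n) x ⊗[ℝ] TangentSpace (𝓡 n) x :=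
  let e : Fin n → TangentSpace (𝓡 n) x := fun a => (EuclideanSpace.single a (1 : ℝ) : Eu n)
  ∑ a, ∑ b, (Matrix.of fun i j => G.inner x (e i) (e j))⁻¹ a b • (e a ⊗ₜ[ℝ] e b)

/-- The length `√(G(v,v))` of a tangent vector. -/
def Metric.length (G : Metric n X) {x : X} (v : TangentSpace (𝓡 n) x) : ℝ :=
  Real.sqrt (G.inner x v v)

/-- The geodesic (Riemannian) distance of `G`: the infimum of the `G`-lengths of `C¹` paths. -/
def Metric.dist (G : Metric n X) (x y : X) : ℝ :=
  letI : ∀ z : X, ENorm (TangentSpace (𝓡 n) z) := fun _ => ⟨fun v => ENNReal.ofReal (G.length v)⟩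
  (Manifold.riemannianEDist (𝓡 n) x y).toReal

/-- The halved squared geodesic distance `σ(x,x')`. -/
def Metric.sigma (G : Metric n X) (x x' : X) : ℝ :=
  G.dist x x' ^ 2 / 2

/-- `c : [0,1] → X` is a minimising geodesic from `x'` to `x`, parametrised proportionally to
arc length: a smooth curve whose constant speed (hence its length) is the distance of its
endpoints. -/
structure IsMinimisingGeodesic (G : Metric n X) (x' x : X) (c : ℝ → X) : Prop where
  source : c 0 = x'
  target : c 1 = x
  smooth : ContMDiffOn 𝓘(ℝ, ℝ) (𝓡 n) ∞ c (Icc 0 1)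
  speed : ∀ t ∈ Icc (0 : ℝ) 1,
    G.length (mfderivWithin 𝓘(ℝ, ℝ) (𝓡 n) c (Icc 0 1) t (1 : ℝ)) = G.dist x' x

/-- `O` is a convex geodesic neighbourhood: an open set any two points of which are joined by a
unique minimising geodesic; this geodesic stays in `O` and depends smoothly on its endpoints. -/
def IsConvexGeodesic (G : Metric n X) (O : Set X) : Prop :=
  IsOpen O ∧ ∃ c : X → X → ℝ → X,
    (∀ x' ∈ O, ∀ x ∈ O, IsMinimisingGeodesic G x' x (c x' x) ∧
      (∀ t ∈ Icc (0 : ℝ) 1, c x' x t ∈ O) ∧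
      ∀ c₂, IsMinimisingGeodesic G x' x c₂ → EqOn c₂ (c x' x) (Icc 0 1)) ∧
    ContMDiffOn (((𝓡 n).prod (𝓡 n)).prod 𝓘(ℝ, ℝ)) (𝓡 n) ∞
      (fun p : (X × X) × ℝ => c p.1.1 p.1.2 p.2) ((O ×ˢ O) ×ˢ Icc 0 1)

end Metric

/-! ### Background data and the operator `E` -/

variable {D : ℕ}
  {S : Type*} [TopologicalSpace S] [ChartedSpace (Eu 2) S] [IsManifold (𝓡 2) ∞ S]
  {M : Type*} [TopologicalSpace M] [ChartedSpace (Eu D) M] [IsManifold (𝓡 D) ∞ M]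

variable (D S M) in
/-- Background data `(ψ, γ, g)`: a smooth map `ψ : S → M` from a surface `S` to the
`D`-dimensional manifold `M` and Riemannian metrics `γ` on `S` and `g` on `M`. -/
structure Background where
  ψ : S → M
  smooth_ψ : ContMDiff (𝓡 2) (𝓡 D) ∞ ψ
  γ : Metric 2 S
  g : Metric D M

/-- The rescaled background `(ψ, λ⁻² γ, g)`. (On a surface the metric `g` is multiplied by
`λ^(dim S - 2) = 1`.) -/
def Background.scale (b : Background D S M) (lam : ℝ) (hlam : 0 < lam) : Background D S M where
  ψ := b.ψ
  smooth_ψ := b.smooth_ψ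
  γ := b.γ.scale (lam ^ (-2 : ℤ)) (zpow_pos hlam _)
  g := b.g

/-- The component `(dψ)^ℓ_α`. -/
def dpsi (b : Background D S M) (φ : OpenPartialHomeomorph S (Eu 2))
    (χ : OpenPartialHomeomorph M (Eu D)) (l : Fin D) (α : Fin 2) (x : S) : ℝ :=
  pd φ α (fun y => χ (b.ψ y) l) x

/-- The component `(∇^ψ u)^i_α = ∂_α uⁱ + (dψ)^ℓ_α Γⁱ_{ℓk}(ψ) u^k` of the pull-back connection,
for a section of `ψ^*TM` with components `uⁱ`. -/
def nabla (b : Background D S M) (φ : OpenPartialHomeomorph S (Eu 2))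
    (χ : OpenPartialHomeomorph M (Eu D)) (u : S → Fin D → ℝ) (α : Fin 2) (i : Fin D) (x : S) : ℝ :=
  pd φ α (fun y => u y i) x
    + ∑ l, ∑ k, dpsi b φ χ l α x * christoffel b.g χ i l k (b.ψ x) * u x k

/-- The component `(∇^ψ∇^ψ u)^i_{αβ}` of the second covariant derivative, where the connection on
`T^*S ⊗ ψ^*TM` is built from the Levi-Civita connection of `γ` and `∇^ψ`. -/
def nabla2 (b : Background D S M) (φ : OpenPartialHomeomorph S (Eu 2))
    (χ : OpenPartialHomeomorph M (Eu D)) (u : S → Fin D → ℝ) (α β : Fin 2) (i : Fin D) (x : S) :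
    ℝ :=
  pd φ α (fun y => nabla b φ χ u β i y) x
    - ∑ δ, christoffel b.γ φ δ α β x * nabla b φ χ u δ i x
    + ∑ l, ∑ k, dpsi b φ χ l α x * christoffel b.g χ i l k (b.ψ x) * nabla b φ χ u β k x

/-- The elliptic operator `E = tr_h (∇^ψ ∘ ∇^ψ)` from sections of `ψ^*TM` to sections of `ψ^*T^*M`:
`(E u)_a = g_{ai}(ψ) γ^{αβ} (∇^ψ∇^ψ u)^i_{αβ}`. -/
def opE (b : Background D S M) (φ : OpenPartialHomeomorph S (Eu 2))
    (χ : OpenPartialHomeomorph M (Eu D)) (u : S → Fin D → ℝ) (a : Fin D) (x : S) : ℝ :=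
  ∑ i, ∑ α, ∑ β, gram b.g χ (b.ψ x) a i * gramInv b.γ φ x α β * nabla2 b φ χ u α β i x

/-- The expression `g_{ai}(ψ) γ^{αβ} (∇^ψ u)^i_α (df)_β`. -/
def nablaAlong (b : Background D S M) (φ : OpenPartialHomeomorph S (Eu 2))
    (χ : OpenPartialHomeomorph M (Eu D)) (u : S → Fin D → ℝ) (f : S → ℝ) (a : Fin D) (x : S) : ℝ :=
  ∑ i, ∑ α, ∑ β,
    gram b.g χ (b.ψ x) a i * gramInv b.γ φ x α β * nabla b φ χ u α i x * pd φ β f x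

/-! ### Bitensors -/

/-- (Not necessarily smooth) sections of `ψ^*TM ⊠ ψ^*TM` over `S × S`. -/
abbrev Bitensor (D : ℕ) {S M : Type*} [TopologicalSpace M] [ChartedSpace (Eu D) M] (ψ : S → M) :=
  (x x' : S) → TangentSpace (𝓡 D) (ψ x) ⊗[ℝ] TangentSpace (𝓡 D) (ψ x')

/-- The component `T^{ij}` of `T ∈ T_yM ⊗ T_{y'}M` with respect to charts `χ` at `y`, `χ'` at
`y'`. -/
def comp (χ χ' : OpenPartialHomeomorph M (Eu D)) {y y' : M}
    (T : TangentSpace (𝓡 D) y ⊗[ℝ] TangentSpace (𝓡 D) y') (i j : Fin D) : ℝ :=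
  LinearMap.mul' ℝ ℝ (TensorProduct.map (coordForm χ y i) (coordForm χ' y' j) T)

/-- `T` is smooth on `O × O`: its components are, in all charts of `M`. -/
def SmoothBitensorOn {ψ : S → M} (O : Set S) (T : Bitensor D ψ) : Prop :=
  ∀ χ ∈ smoothCharts D M, ∀ χ' ∈ smoothCharts D M, ∀ i j,
    ContMDiffOn ((𝓡 2).prod (𝓡 2)) 𝓘(ℝ, ℝ) ∞
      (fun p : S × S => comp χ χ' (T p.1 p.2) i j)
      ((O ×ˢ O) ∩ {p | ψ p.1 ∈ χ.source ∧ ψ p.2 ∈ χ'.source})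

/-- `T` is symmetric on `O × O`: exchanging the two tensor factors of `T(x,x')` gives `T(x',x)`. -/
def SymmBitensorOn {ψ : S → M} (O : Set S) (T : Bitensor D ψ) : Prop :=
  ∀ x ∈ O, ∀ x' ∈ O, TensorProduct.comm ℝ _ _ (T x x') = T x' x

/-- `T = O(σ^N)` at the diagonal of `O × O`, when `(x,x')` tends to a point of the diagonal inside
`A ⊆ S × S`. -/
def BigOSigma (γ : Metric 2 S) {ψ : S → M} (O : Set S) (A : Set (S × S)) (T : Bitensor D ψ)
    (N : ℕ) : Prop :=
  ∀ x₀ ∈ O, ∀ χ ∈ smoothCharts D M, ∀ χ' ∈ smoothCharts D M,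
    ψ x₀ ∈ χ.source → ψ x₀ ∈ χ'.source → ∀ i j,
    (fun p : S × S => comp χ χ' (T p.1 p.2) i j) =O[𝓝[A] (x₀, x₀)]
      fun p : S × S => γ.sigma p.1 p.2 ^ N

/-! ### The Hadamard parametrix -/

/-- `(V_n)` are the Hadamard coefficients of `E` on `O`: smooth bitensors solving the hierarchy of
transport equations, with `[V_0]` the inverse of `g`. All derivatives act on the first variable
`x`; the second variable `x'` and the second index `j` are parameters. -/
structure IsHadamardSeq (b : Background D S M) (O : Set S) (V : ℕ → Bitensor D b.ψ) : Prop where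
  smooth : ∀ n, SmoothBitensorOn O (V n)
  init : ∀ x ∈ O, V 0 x x = inverseMetric b.g (b.ψ x)
  transport_zero : ∀ φ ∈ smoothCharts 2 S, ∀ χ ∈ smoothCharts D M, ∀ χ' ∈ smoothCharts D M,
    ∀ x ∈ O, ∀ x' ∈ O, x ∈ φ.source → b.ψ x ∈ χ.source → b.ψ x' ∈ χ'.source → ∀ a j,
      2 * nablaAlong b φ χ (fun y i => comp χ χ' (V 0 y x') i j)
          (fun y => b.γ.sigma y x') a x
        + (∑ i, gram b.g χ (b.ψ x) a i * comp χ χ' (V 0 x x') i j)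
          * (laplacian b.γ φ (fun y => b.γ.sigma y x') x - 2) = 0
  transport_pos : ∀ n : ℕ, 1 ≤ n →
    ∀ φ ∈ smoothCharts 2 S, ∀ χ ∈ smoothCharts D M, ∀ χ' ∈ smoothCharts D M,
    ∀ x ∈ O, ∀ x' ∈ O, x ∈ φ.source → b.ψ x ∈ χ.source → b.ψ x' ∈ χ'.source → ∀ a j,
      opE b φ χ (fun y i => comp χ χ' (V (n - 1) y x') i j) a x
        + 2 * (n : ℝ) * nablaAlong b φ χ (fun y i => comp χ χ' (V n y x') i j)
          (fun y => b.γ.sigma y x') a x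
        + (n : ℝ) * (∑ i, gram b.g χ (b.ψ x) a i * comp χ χ' (V n x x') i j)
          * (laplacian b.γ φ (fun y => b.γ.sigma y x') x + 2 * ((n : ℝ) - 1)) = 0

/-- The partial sum `∑_{n<N} V_n σⁿ`, with `σ` built from `γ`. -/
def partialSum (γ : Metric 2 S) {ψ : S → M} (V : ℕ → Bitensor D ψ) (N : ℕ) : Bitensor D ψ :=
  fun x x' => ∑ n ∈ Finset.range N, γ.sigma x x' ^ n • V n x x'

/-- `V` is a sum of the formal power series `∑ V_n σⁿ` on `O`: a smooth bitensor on `O × O` whose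
expansion at the diagonal is that series. (A series made convergent by suitable cut-off functions
equal to `1` near the diagonal gives such a `V`.) -/
structure IsHadamardSum (γ : Metric 2 S) {ψ : S → M} (O : Set S) (Vn : ℕ → Bitensor D ψ)
    (V : Bitensor D ψ) : Prop where
  smooth : SmoothBitensorOn O V
  expansion : ∀ N, BigOSigma γ O univ (fun x x' => V x x' - partialSum γ Vn N x x') N

/-- The bitensor `V log (σ / ℓ²)`, used off the diagonal. For `V` a sum of `∑ V_n σⁿ` this is the
Hadamard parametrix; for `V` a partial sum, the truncated Hadamard parametrix. -/
def logKernel (γ : Metric 2 S) {ψ : S → M} (l : ℝ) (V : Bitensor D ψ) : Bitensor D ψ :=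
  fun x x' => Real.log (γ.sigma x x' / l ^ 2) • V x x'

end HadamardScaling

end

/-!
The scaling behaviour of the coefficients is algebra: replacing `γ` by `λ⁻² γ` leaves the
Christoffel symbols alone and multiplies the inverse metric by `λ²` and `σ` by `λ⁻²`, so the
transport equations for `λ^(2n) V_n` are multiples of the original ones
(`isHadamardSeq_scale_iff`), and the formal series `∑ V_n σⁿ` does not change. Everything else
about the parametrices follows from `log (λ⁻² σ / ℓ²) = log (σ / ℓ²) - 2 log λ` off the diagonal,
from `σ log σ → 0` at the diagonal, and from the fact that a smooth bitensor that is `O(σ)` off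
the diagonal vanishes on it.

The analytic content is the uniqueness of the coefficients (`IsHadamardSeq.unique`). Let `c` be
the minimising geodesic from `x'` to `x`. The function `σ` is smooth on `O × O`, being half the
squared initial velocity of a geodesic that depends smoothly on its endpoints
(`IsConvexGeodesic.contMDiffOn_sigma`). The gradient of `σ(·, x')` at `c(t)` is `t c'(t)`: the
triangle inequality bounds the norm of `dσ` by the distance to `x'`, and the bound is attained on
the velocity, so that the equality case of the Cauchy-Schwarz inequality applies
(`IsMinimisingGeodesic.pd_sigma`). Hence the difference `w` of two solutions of the `n`-th
transport equation satisfies, along `c`, `2 t ∇w/dt + (Δσ - 2 + 2 n) w = 0` (`transport_ode`).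
Here `Δσ = 2` on the diagonal; this is read off from the zeroth transport equation at `x = x'`,
where `dσ = 0` and `V₀` is invertible (`IsHadamardSeq.laplacian_sigma_self`). So `tⁿ w` solves a
linear system with bounded coefficients, vanishes at `t = 0`, and is zero by Grönwall's
inequality. As the argument is local in `t`, it is carried out in charts of the target manifold,
and a connectedness argument on `[0, 1]` concludes (`transport_unique`).
-/

set_option linter.unusedSectionVars false

noncomputable section

namespace HadamardScaling

/-! ### Calculus in charts -/

section ChartCalculus

variable {n : ℕ} {X : Type*} [TopologicalSpace X] [ChartedSpace (Eu n) X] [IsManifold (𝓡 n) ∞ X]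
  {χ : OpenPartialHomeomorph X (Eu n)} {x : X}

lemma mdifferentiable_of_mem_smoothCharts (hχ : χ ∈ smoothCharts n X) :
    χ.MDifferentiable (𝓡 n) (𝓡 n) :=
  ⟨(contMDiffOn_of_mem_maximalAtlas hχ).mdifferentiableOn (by simp),
    (contMDiffOn_symm_of_mem_maximalAtlas hχ).mdifferentiableOn (by simp)⟩

lemma isInvertible_chartDiff (hχ : χ ∈ smoothCharts n X) (hx : x ∈ χ.source) :
    (chartDiff χ x).IsInvertible :=
  ⟨(mdifferentiable_of_mem_smoothCharts hχ).mfderiv hx, rfl⟩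

lemma chartDiff_coordVec (hχ : χ ∈ smoothCharts n X) (hx : x ∈ χ.source) (a : Fin n) :
    chartDiff χ x (coordVec χ x a) = EuclideanSpace.single a 1 := by
  obtain ⟨e, he⟩ := isInvertible_chartDiff hχ hx
  rw [coordVec, ← he, ContinuousLinearMap.inverse_equiv]
  exact e.apply_symm_apply _

lemma chartDiff_injective (hχ : χ ∈ smoothCharts n X) (hx : x ∈ χ.source) :
    Function.Injective (chartDiff χ x) := by
  obtain ⟨e, he⟩ := isInvertible_chartDiff hχ hx
  rw [← he]
  exact e.injective

lemma eq_sum_coordVec (hχ : χ ∈ smoothCharts n X) (hx : x ∈ χ.source)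
    (v : TangentSpace (𝓡 n) x) : v = ∑ a, chartDiff χ x v a • coordVec χ x a := by
  apply chartDiff_injective hχ hx
  rw [map_sum]
  simp_rw [map_smul, chartDiff_coordVec hχ hx]
  ext i
  simp [Pi.single_apply]

lemma inner_eq_sum_gram (G : Metric n X) (hχ : χ ∈ smoothCharts n X) (hx : x ∈ χ.source)
    (v w : TangentSpace (𝓡 n) x) :
    G.inner x v w = ∑ a, ∑ b, gram G χ x a b * chartDiff χ x v a * chartDiff χ x w b := by
  conv_lhs => rw [eq_sum_coordVec hχ hx v, eq_sum_coordVec hχ hx w]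
  simp only [map_sum, map_smul, _root_.sum_apply, _root_.smul_apply,
    smul_eq_mul, gram, Matrix.of_apply]
  simp_rw [Finset.mul_sum]
  rw [Finset.sum_comm]
  exact Finset.sum_congr rfl fun a _ => Finset.sum_congr rfl fun b _ => by ring

lemma gram_symm (G : Metric n X) (a b : Fin n) : gram G χ x a b = gram G χ x b a := by
  simp only [gram, Matrix.of_apply]
  exact G.symm x _ _

/-- The Gram matrix of a linearly independent family is invertible. -/
lemma isUnit_det_of_inner (G : Metric n X) {e : Fin n → TangentSpace (𝓡 n) x}
    (he : ∀ v : Fin n → ℝ, ∑ a, v a • e a = 0 → v = 0) :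
    IsUnit (Matrix.of fun a b => G.inner x (e a) (e b)).det := by
  rw [isUnit_iff_ne_zero]
  intro h
  obtain ⟨v, hv, hv0⟩ := Matrix.exists_mulVec_eq_zero_iff.2 h
  refine hv (he v ?_)
  by_contra hne
  refine (G.pos x _ hne).ne' ?_
  simp only [map_sum, map_smul, _root_.sum_apply, _root_.smul_apply, smul_eq_mul]
  refine Finset.sum_eq_zero fun a _ => ?_
  have h1 : ∑ b, G.inner x (e a) (e b) * v b = 0 := congrFun hv0 a
  calc _ = v a * ∑ b, G.inner x (e a) (e b) * v b := by
        congr 1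
        exact Finset.sum_congr rfl fun b _ => by rw [G.symm x (e b) (e a), mul_comm]
    _ = 0 := by rw [h1, mul_zero]

lemma isUnit_det_gram (G : Metric n X) (hχ : χ ∈ smoothCharts n X) (hx : x ∈ χ.source) :
    IsUnit (gram G χ x).det := by
  refine isUnit_det_of_inner G fun v hv => ?_
  have h := congrArg (chartDiff χ x) hv
  rw [map_sum, map_zero] at h
  simp_rw [map_smul, chartDiff_coordVec hχ hx] at h
  ext a
  have h1 := congrArg (fun w : Eu n => w a) h
  simpa [Pi.single_apply] using h1

lemma sum_gram_mul_eq_zero (G : Metric n X) (hχ : χ ∈ smoothCharts n X) (hx : x ∈ χ.source)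
    {v : Fin n → ℝ} (h : ∀ a, ∑ i, gram G χ x a i * v i = 0) : v = 0 := by
  by_contra hv
  exact (isUnit_det_gram G hχ hx).ne_zero
    (Matrix.exists_mulVec_eq_zero_iff.1 ⟨v, hv, funext h⟩)

lemma sum_gramInv_mul_gram (G : Metric n X) (hχ : χ ∈ smoothCharts n X) (hx : x ∈ χ.source)
    (v : Fin n → ℝ) (a : Fin n) :
    ∑ b, gramInv G χ x a b * ∑ c, gram G χ x b c * v c = v a := by
  have h : (gramInv G χ x).mulVec ((gram G χ x).mulVec v) = v := by
    rw [Matrix.mulVec_mulVec, gramInv, Matrix.nonsing_inv_mul _ (isUnit_det_gram G hχ hx),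
      Matrix.one_mulVec]
  exact congrFun h a

lemma contMDiffAt_pd (hχ : χ ∈ smoothCharts n X) (hx : x ∈ χ.source) {f : X → ℝ}
    (hf : ContMDiffAt (𝓡 n) 𝓘(ℝ, ℝ) ∞ f x) (a : Fin n) :
    ContMDiffAt (𝓡 n) 𝓘(ℝ, ℝ) ∞ (pd χ a f) x := by
  have h1 : ContMDiffAt (𝓡 n) 𝓘(ℝ, ℝ) ∞ (f ∘ χ.symm) (χ x) := by
    refine ContMDiffAt.comp (χ x) ?_ (contMDiffAt_symm_of_mem_maximalAtlas hχ (χ.map_source hx))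
    rwa [χ.left_inv hx]
  have h2 : ContDiffAt ℝ ∞ (fun u => fderiv ℝ (f ∘ χ.symm) u (EuclideanSpace.single a 1)) (χ x) :=
    (h1.contDiffAt.fderiv_right (m := ∞) (by simp)).clm_apply contDiffAt_const
  exact h2.contMDiffAt.comp x (contMDiffAt_of_mem_maximalAtlas hχ hx)

/-- The coordinate vector fields are smooth, being pull-backs of constant fields by the chart. -/
lemma contMDiffAt_coordVec (hχ : χ ∈ smoothCharts n X) (hx : x ∈ χ.source) (a : Fin n) :
    ContMDiffAt (𝓡 n) ((𝓡 n).prod (𝓡 n)) ∞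
      (fun y => Bundle.TotalSpace.mk' (Eu n) y (coordVec χ y a)) x := by
  have hV : ContMDiffAt (𝓡 n) ((𝓡 n).prod (𝓡 n)) ∞
      (fun y : Eu n => (Bundle.TotalSpace.mk' (Eu n) y
        (EuclideanSpace.single a (1 : ℝ) : Eu n) : TangentBundle (𝓡 n) (Eu n))) (χ x) :=
    (contMDiffAt_vectorSpace_iff_contDiffAt
      (V := fun _ => (EuclideanSpace.single a (1 : ℝ) : Eu n))).2 contDiffAt_const
  exact ContMDiffAt.mpullback_vectorField_preimage (f := χ) (n := ∞) hV
    (contMDiffAt_of_mem_maximalAtlas hχ hx) (isInvertible_chartDiff hχ hx) (by simp)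

lemma contMDiffAt_gram (G : Metric n X) (hχ : χ ∈ smoothCharts n X) (hx : x ∈ χ.source)
    (a b : Fin n) : ContMDiffAt (𝓡 n) 𝓘(ℝ, ℝ) ∞ (fun y => gram G χ y a b) x := by
  have := ContMDiffAt.clm_bundle_apply₂ (F₁ := Eu n) (F₂ := Eu n) (F₃ := ℝ)
    (E₃ := Bundle.Trivial X ℝ) (b := fun y : X => y) (G.contMDiff x)
    (contMDiffAt_coordVec hχ hx a) (contMDiffAt_coordVec hχ hx b)
  rw [Bundle.contMDiffAt_section] at this
  exact this

lemma contMDiffAt_gramInv (G : Metric n X) (hχ : χ ∈ smoothCharts n X) (hx : x ∈ χ.source)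
    (a b : Fin n) : ContMDiffAt (𝓡 n) 𝓘(ℝ, ℝ) ∞ (fun y => gramInv G χ y a b) x := by
  have hg := contMDiffAt_gram G hχ hx
  have hdet : ∀ A : X → Matrix (Fin n) (Fin n) ℝ,
      (∀ i j, ContMDiffAt (𝓡 n) 𝓘(ℝ, ℝ) ∞ (fun y => A y i j) x) →
        ContMDiffAt (𝓡 n) 𝓘(ℝ, ℝ) ∞ (fun y => (A y).det) x := by
    intro A hA
    simp_rw [Matrix.det_apply']
    exact ContMDiffAt.sum fun σ _ =>
      contMDiffAt_const.mul (ContMDiffAt.prod fun i _ => hA _ _)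
  have hadj : ContMDiffAt (𝓡 n) 𝓘(ℝ, ℝ) ∞ (fun y => (gram G χ y).adjugate a b) x := by
    simp_rw [Matrix.adjugate_apply]
    refine hdet _ fun i j => ?_
    by_cases hi : i = b
    · simp only [Matrix.updateRow_apply, hi, if_true]
      exact contMDiffAt_const
    · simp only [Matrix.updateRow_apply, hi, if_false]
      exact hg i j
  have hinv : ContMDiffAt (𝓡 n) 𝓘(ℝ, ℝ) ∞ (fun y => (gram G χ y).det⁻¹) x :=
    (contDiffAt_inv ℝ (isUnit_det_gram G hχ hx).ne_zero).contMDiffAt.comp x (hdet _ hg)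
  refine (hinv.mul hadj).congr_of_eventuallyEq (Eventually.of_forall fun y => ?_)
  simp [gramInv, Matrix.inv_def]

lemma contMDiffAt_christoffel (G : Metric n X) (hχ : χ ∈ smoothCharts n X) (hx : x ∈ χ.source)
    (a b c : Fin n) : ContMDiffAt (𝓡 n) 𝓘(ℝ, ℝ) ∞ (christoffel G χ a b c) x := by
  have hp := fun i j k => contMDiffAt_pd hχ hx (contMDiffAt_gram G hχ hx i j) k
  unfold christoffel
  refine contMDiffAt_const.mul ?_
  refine ContMDiffAt.sum fun d _ => (contMDiffAt_gramInv G hχ hx a d).mul ?_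
  exact ((hp d c b).add (hp d b c)).sub (hp b c d)

lemma contMDiffAt_laplacian (G : Metric n X) (hχ : χ ∈ smoothCharts n X) (hx : x ∈ χ.source)
    {f : X → ℝ} (hf : ContMDiffAt (𝓡 n) 𝓘(ℝ, ℝ) ∞ f x) :
    ContMDiffAt (𝓡 n) 𝓘(ℝ, ℝ) ∞ (laplacian G χ f) x := by
  unfold laplacian
  refine ContMDiffAt.sum fun a _ => ContMDiffAt.sum fun b _ =>
    (contMDiffAt_gramInv G hχ hx a b).mul ?_
  refine (contMDiffAt_pd hχ hx (contMDiffAt_pd hχ hx hf b) a).sub ?_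
  exact ContMDiffAt.sum fun d _ =>
    (contMDiffAt_christoffel G hχ hx d a b).mul (contMDiffAt_pd hχ hx hf d)

end ChartCalculus

/-! ### A Grönwall argument for linear systems -/

/-- A solution of a linear system with bounded coefficients on the right of `t₀` that tends to zero
at `t₀` vanishes near `t₀`. Nothing is assumed at `t₀` itself, where the coefficients may be
undefined. -/
lemma eventually_eq_zero_of_linear_ode {ι : Type*} [Fintype ι] {y : ℝ → ι → ℝ}
    {B : ι → ι → ℝ → ℝ} {t₀ : ℝ} (hy : Tendsto y (𝓝[>] t₀) (𝓝 0))
    (hB : ∀ i k, B i k =O[𝓝[>] t₀] fun _ => (1 : ℝ))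
    (hode : ∀ᶠ s in 𝓝[>] t₀, ∀ i, HasDerivAt (fun r => y r i) (∑ k, B i k s * y s k) s) :
    ∀ᶠ s in 𝓝[>] t₀, y s = 0 := by
  choose C hC using fun i k => (hB i k).bound
  have hC' : ∀ᶠ s in 𝓝[>] t₀, ∀ i k, |B i k s| ≤ C i k := by
    rw [eventually_all]
    intro i
    rw [eventually_all]
    intro k
    filter_upwards [hC i k] with s hs
    simpa using hs
  obtain ⟨u, hu, hu'⟩ := mem_nhdsGT_iff_exists_Ioo_subset.1 (hode.and hC')
  set K : ℝ := ∑ i, ∑ k, |C i k| with hK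
  have hK0 : 0 ≤ K := Finset.sum_nonneg fun i _ => Finset.sum_nonneg fun k _ => abs_nonneg _
  have hbound : ∀ s ∈ Ioo t₀ u, ‖fun i => ∑ k, B i k s * y s k‖ ≤ K * ‖y s‖ := by
    intro s hs
    rw [pi_norm_le_iff_of_nonneg (by positivity)]
    intro i
    calc ‖∑ k, B i k s * y s k‖ ≤ ∑ k, ‖B i k s * y s k‖ := norm_sum_le _ _
      _ ≤ ∑ k, |C i k| * ‖y s‖ := by
          refine Finset.sum_le_sum fun k _ => ?_
          rw [norm_mul]
          exact mul_le_mul (((hu' hs).2 i k).trans (le_abs_self _)) (norm_le_pi_norm _ k)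
            (norm_nonneg _) (abs_nonneg _)
      _ = (∑ k, |C i k|) * ‖y s‖ := by rw [Finset.sum_mul]
      _ ≤ K * ‖y s‖ := by
          gcongr
          exact Finset.single_le_sum (f := fun i => ∑ k, |C i k|)
            (fun i _ => Finset.sum_nonneg fun k _ => abs_nonneg _) (Finset.mem_univ i)
  have hder : ∀ s ∈ Ioo t₀ u, HasDerivAt y (fun i => ∑ k, B i k s * y s k) s :=
    fun s hs => hasDerivAt_pi.2 (hu' hs).1
  filter_upwards [Ioo_mem_nhdsGT hu] with s hs
  -- Grönwall's inequality on `[ε, s]`; then `ε` tends to `t₀`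
  have hgr : ∀ ε ∈ Ioo t₀ s, ‖y s‖ ≤ ‖y ε‖ * Real.exp (K * (s - t₀)) := by
    intro ε hε
    have hsub : Icc ε s ⊆ Ioo t₀ u := fun r hr => ⟨hε.1.trans_le hr.1, hr.2.trans_lt hs.2⟩
    have := norm_le_gronwallBound_of_norm_deriv_right_le (f := y)
      (f' := fun s i => ∑ k, B i k s * y s k) (δ := ‖y ε‖) (K := K) (ε := 0) (a := ε) (b := s)
      (fun r hr => (hder r (hsub hr)).continuousAt.continuousWithinAt)
      (fun r hr => (hder r (hsub ⟨hr.1, hr.2.le⟩)).hasDerivWithinAt) le_rfl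
      (fun r hr => by simpa using hbound r (hsub ⟨hr.1, hr.2.le⟩)) s ⟨hε.2.le, le_rfl⟩
    rw [gronwallBound_ε0] at this
    refine this.trans ?_
    gcongr
    exact hε.1.le
  have hlim : Tendsto (fun ε => ‖y ε‖ * Real.exp (K * (s - t₀))) (𝓝[>] t₀) (𝓝 0) := by
    simpa using hy.norm.mul_const (Real.exp (K * (s - t₀)))
  have := ge_of_tendsto hlim (by filter_upwards [Ioo_mem_nhdsGT hs.1] with ε hε using hgr ε hε)
  exact norm_le_zero_iff.1 this

/-! ### Riemannian distance and minimising geodesics -/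

section Distance

variable {n : ℕ} {X : Type*} [TopologicalSpace X] [ChartedSpace (Eu n) X] [IsManifold (𝓡 n) ∞ X]
  {χ : OpenPartialHomeomorph X (Eu n)} {x x' : X}

lemma hasDerivAt_chart_comp {c : ℝ → X} (hχ : χ ∈ smoothCharts n X) {t : ℝ}
    (hc : MDifferentiableAt 𝓘(ℝ, ℝ) (𝓡 n) c t) (hx : c t ∈ χ.source) :
    HasDerivAt (fun s => χ (c s)) (chartDiff χ (c t) (mfderiv 𝓘(ℝ, ℝ) (𝓡 n) c t (1 : ℝ))) t := by
  have h2 : MDifferentiableAt (𝓡 n) (𝓡 n) χ (c t) :=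
    (contMDiffAt_of_mem_maximalAtlas hχ hx).mdifferentiableAt (by simp)
  have h3 : HasFDerivAt (𝕜 := ℝ) (E := ℝ) (F := Eu n) (fun s => χ (c s))
      ((chartDiff χ (c t)).comp (mfderiv 𝓘(ℝ, ℝ) (𝓡 n) c t)) t :=
    (h2.hasMFDerivAt.comp t hc.hasMFDerivAt).hasFDerivAt
  exact h3.hasDerivAt

/-- The extended norm on tangent vectors given by the length with respect to `G`. -/
abbrev Metric.tangentENorm (G : Metric n X) (z : X) : ENorm (TangentSpace (𝓡 n) z) :=
  ⟨fun v => ENNReal.ofReal (G.length v)⟩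

/-- The geodesic distance of `G` with values in `[0, ∞]`. -/
def Metric.edist (G : Metric n X) (x y : X) : ENNReal :=
  letI := G.tangentENorm
  Manifold.riemannianEDist (𝓡 n) x y

lemma Metric.dist_eq (G : Metric n X) (x y : X) : G.dist x y = (G.edist x y).toReal := rfl

lemma Metric.dist_nonneg (G : Metric n X) (x y : X) : 0 ≤ G.dist x y := ENNReal.toReal_nonneg

lemma Metric.inner_self_nonneg (G : Metric n X) (v : TangentSpace (𝓡 n) x) :
    0 ≤ G.inner x v v := by
  rcases eq_or_ne v 0 with rfl | hv
  · simp
  · exact (G.pos x v hv).le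

lemma Metric.length_sq (G : Metric n X) (v : TangentSpace (𝓡 n) x) :
    G.length v ^ 2 = G.inner x v v := Real.sq_sqrt (G.inner_self_nonneg v)

lemma Metric.length_smul (G : Metric n X) (r : ℝ) (v : TangentSpace (𝓡 n) x) :
    G.length (r • v) = |r| * G.length v := by
  rw [Metric.length, Metric.length, ← Real.sqrt_sq_eq_abs, ← Real.sqrt_mul (sq_nonneg r)]
  congr 1
  simp only [map_smul, _root_.smul_apply, smul_eq_mul]
  ring

lemma Metric.eNormSMulClass (G : Metric n X) (z : X) :
    letI := G.tangentENorm z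
    ENormSMulClass ℝ (TangentSpace (𝓡 n) z) :=
  letI := G.tangentENorm z
  ⟨fun r v => by
    change ENNReal.ofReal (G.length (r • v)) = ‖r‖ₑ * ENNReal.ofReal (G.length v)
    rw [G.length_smul, ENNReal.ofReal_mul (abs_nonneg r), Real.enorm_eq_ofReal_abs]⟩

lemma Metric.edist_self (G : Metric n X) (x : X) : G.edist x x = 0 :=
  letI := G.tangentENorm
  haveI := G.eNormSMulClass
  Manifold.riemannianEDist_self

lemma Metric.edist_comm (G : Metric n X) (x y : X) : G.edist x y = G.edist y x :=
  letI := G.tangentENorm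
  haveI := G.eNormSMulClass
  Manifold.riemannianEDist_comm

lemma Metric.edist_triangle (G : Metric n X) (x y z : X) :
    G.edist x z ≤ G.edist x y + G.edist y z :=
  letI := G.tangentENorm
  haveI := G.eNormSMulClass
  Manifold.riemannianEDist_triangle

lemma Metric.dist_self (G : Metric n X) (x : X) : G.dist x x = 0 := by
  rw [G.dist_eq, G.edist_self, ENNReal.toReal_zero]

lemma Metric.dist_comm (G : Metric n X) (x y : X) : G.dist x y = G.dist y x := by
  rw [G.dist_eq, G.dist_eq, G.edist_comm]

lemma Metric.sigma_self (G : Metric n X) (x : X) : G.sigma x x = 0 := by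
  simp [Metric.sigma, G.dist_self]

lemma Metric.edist_le_of_length_le (G : Metric n X) {c : ℝ → X} {a b K : ℝ} (hab : a ≤ b)
    (hK : 0 ≤ K) (hc : ContMDiffOn 𝓘(ℝ, ℝ) (𝓡 n) 1 c (Icc a b))
    (h : ∀ t ∈ Ioo a b, G.length (mfderiv 𝓘(ℝ, ℝ) (𝓡 n) c t (1 : ℝ)) ≤ K) :
    G.edist (c a) (c b) ≤ ENNReal.ofReal (K * (b - a)) := by
  let _ := G.tangentENorm
  have _ := G.eNormSMulClass
  refine (Manifold.riemannianEDist_le_pathELength hc rfl rfl hab).trans ?_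
  rw [Manifold.pathELength_eq_lintegral_mfderiv_Ioo]
  calc _ ≤ ∫⁻ _ in Ioo a b, ENNReal.ofReal K :=
        MeasureTheory.setLIntegral_mono' measurableSet_Ioo fun t ht =>
          ENNReal.ofReal_le_ofReal (h t ht)
    _ = ENNReal.ofReal (K * (b - a)) := by
        rw [MeasureTheory.setLIntegral_const, Real.volume_Ioo, ENNReal.ofReal_mul hK]

lemma Metric.length_scale (G : Metric n X) {r : ℝ} (hr : 0 < r) (v : TangentSpace (𝓡 n) x) :
    (G.scale r hr).length v = Real.sqrt r * G.length v := by
  rw [Metric.length, Metric.length, ← Real.sqrt_mul hr.le]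
  rfl

lemma Metric.edist_scale (G : Metric n X) {r : ℝ} (hr : 0 < r) (x y : X) :
    (G.scale r hr).edist x y = ENNReal.ofReal (Real.sqrt r) * G.edist x y := by
  have h0 : ENNReal.ofReal (Real.sqrt r) ≠ 0 := by simpa using hr
  simp only [Metric.edist, Manifold.riemannianEDist]
  rw [ENNReal.mul_iInf_of_ne h0 ENNReal.ofReal_ne_top]
  refine iInf_congr fun p => ?_
  rw [ENNReal.mul_iInf_of_ne h0 ENNReal.ofReal_ne_top]
  refine iInf_congr fun _ => ?_
  rw [← MeasureTheory.lintegral_const_mul' _ _ ENNReal.ofReal_ne_top]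
  refine MeasureTheory.lintegral_congr fun t => ?_
  change ENNReal.ofReal ((G.scale r hr).length _) = _ * ENNReal.ofReal (G.length _)
  rw [G.length_scale hr, ENNReal.ofReal_mul (Real.sqrt_nonneg r)]

lemma Metric.sigma_scale (G : Metric n X) {r : ℝ} (hr : 0 < r) (x y : X) :
    (G.scale r hr).sigma x y = r * G.sigma x y := by
  rw [Metric.sigma, Metric.sigma, Metric.dist_eq, Metric.dist_eq, G.edist_scale hr,
    ENNReal.toReal_mul, ENNReal.toReal_ofReal (Real.sqrt_nonneg r), mul_pow, Real.sq_sqrt hr.le]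
  ring

namespace IsMinimisingGeodesic

variable {G : Metric n X} {c : ℝ → X}

lemma length_mfderiv (h : IsMinimisingGeodesic G x' x c) {t : ℝ} (ht : t ∈ Ioo (0 : ℝ) 1) :
    G.length (mfderiv 𝓘(ℝ, ℝ) (𝓡 n) c t (1 : ℝ)) = G.dist x' x := by
  have := h.speed t ⟨ht.1.le, ht.2.le⟩
  rwa [mfderivWithin_of_mem_nhds (Icc_mem_nhds ht.1 ht.2)] at this

lemma contMDiffAt (h : IsMinimisingGeodesic G x' x c) {t : ℝ} (ht : t ∈ Ioo (0 : ℝ) 1) :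
    ContMDiffAt 𝓘(ℝ, ℝ) (𝓡 n) ∞ c t :=
  (h.smooth t ⟨ht.1.le, ht.2.le⟩).contMDiffAt (Icc_mem_nhds ht.1 ht.2)

lemma edist_le (h : IsMinimisingGeodesic G x' x c) {s t : ℝ} (hs : 0 ≤ s) (hst : s ≤ t)
    (ht : t ≤ 1) : G.edist (c s) (c t) ≤ ENNReal.ofReal (G.dist x' x * (t - s)) :=
  G.edist_le_of_length_le hst (G.dist_nonneg _ _)
    ((h.smooth.of_le (by simp)).mono (Icc_subset_Icc hs ht))
    fun r hr => (h.length_mfderiv ⟨hs.trans_lt hr.1, hr.2.trans_le ht⟩).le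

lemma edist_ne_top (h : IsMinimisingGeodesic G x' x c) {t : ℝ} (ht : t ∈ Icc (0 : ℝ) 1) :
    G.edist x' (c t) ≠ ⊤ := by
  have := h.edist_le le_rfl ht.1 ht.2
  rw [h.source] at this
  exact ne_top_of_le_ne_top ENNReal.ofReal_ne_top this

/-- The distance from the initial point grows linearly along a minimising geodesic. -/
lemma dist_eq (h : IsMinimisingGeodesic G x' x c) {t : ℝ} (ht : t ∈ Icc (0 : ℝ) 1) :
    G.dist x' (c t) = t * G.dist x' x := by
  have hd := G.dist_nonneg x' x
  have h1 := h.edist_le le_rfl ht.1 ht.2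
  have h2 := h.edist_le ht.1 ht.2 le_rfl
  rw [h.source, sub_zero] at h1
  rw [h.target] at h2
  have h1' : G.dist x' (c t) ≤ G.dist x' x * t :=
    ENNReal.toReal_le_of_le_ofReal (mul_nonneg hd ht.1) h1
  have h2' : G.dist (c t) x ≤ G.dist x' x * (1 - t) :=
    ENNReal.toReal_le_of_le_ofReal (mul_nonneg hd (by linarith [ht.2])) h2
  have h3 : G.dist x' x ≤ G.dist x' (c t) + G.dist (c t) x := by
    simp only [Metric.dist_eq]
    have f1 := ne_top_of_le_ne_top ENNReal.ofReal_ne_top h1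
    have f2 := ne_top_of_le_ne_top ENNReal.ofReal_ne_top h2
    rw [← ENNReal.toReal_add f1 f2]
    exact ENNReal.toReal_mono (ENNReal.add_ne_top.2 ⟨f1, f2⟩) (G.edist_triangle _ _ _)
  nlinarith

lemma hasDerivAt_chart (h : IsMinimisingGeodesic G x' x c) (hχ : χ ∈ smoothCharts n X) {t : ℝ}
    (ht : t ∈ Ioo (0 : ℝ) 1) (hx : c t ∈ χ.source) :
    HasDerivAt (fun s => χ (c s)) (chartDiff χ (c t) (mfderiv 𝓘(ℝ, ℝ) (𝓡 n) c t (1 : ℝ))) t :=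
  hasDerivAt_chart_comp hχ ((h.contMDiffAt ht).mdifferentiableAt (by simp)) hx

/-- A minimising geodesic of length zero is constant, so that the distance separates its
endpoints. -/
lemma eq_of_dist_eq_zero [T2Space X] (h : IsMinimisingGeodesic G x' x c)
    (hd : G.dist x' x = 0) : x = x' := by
  have hcont : ContinuousOn c (Icc 0 1) := h.smooth.continuousOn
  have hsub : Icc (0 : ℝ) 1 ⊆ {t | c t = x'} := by
    refine IsClosed.Icc_subset_of_forall_mem_nhdsWithin ?_ h.source ?_
    · rw [inter_comm]
      exact hcont.preimage_isClosed_of_isClosed isClosed_Icc isClosed_singleton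
    · rintro t ⟨ht, ht0, ht1⟩
      have hct : c t = x' := ht
      set χ := chartAt (Eu n) x'
      have hχ : χ ∈ smoothCharts n X := IsManifold.chart_mem_maximalAtlas x'
      have hxs : x' ∈ χ.source := mem_chart_source _ x'
      have hev : ∀ᶠ s in 𝓝[>] t, s ∈ Ioo (0 : ℝ) 1 := by
        filter_upwards [Ioo_mem_nhdsGT ht1] with s hs using ⟨ht0.trans_lt hs.1, hs.2⟩
      have hle : 𝓝[>] t ≤ 𝓝[Icc 0 1] t := by
        rw [← nhdsWithin_Ioo_eq_nhdsGT ht1]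
        exact nhdsWithin_mono _ fun s hs => ⟨ht0.trans hs.1.le, hs.2.le⟩
      have htend : Tendsto c (𝓝[>] t) (𝓝 x') := by
        have := (hcont t ⟨ht0, ht1.le⟩).mono_left hle
        rwa [hct] at this
      have hsrc : ∀ᶠ s in 𝓝[>] t, c s ∈ χ.source := htend (χ.open_source.mem_nhds hxs)
      -- the coordinates have zero derivative, so they are constant
      have hz : ∀ᶠ s in 𝓝[>] t, (fun i => χ (c s) i - χ x' i) = 0 := by
        refine eventually_eq_zero_of_linear_ode (B := fun _ _ _ => 0) ?_
          (fun i k => Asymptotics.isBigO_zero _ _) ?_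
        · have h1 : Tendsto (fun s => χ (c s)) (𝓝[>] t) (𝓝 (χ x')) :=
            (χ.continuousAt hxs).tendsto.comp htend
          rw [tendsto_pi_nhds]
          intro i
          have h2 := ((EuclideanSpace.proj i : Eu n →L[ℝ] ℝ).continuous.tendsto _).comp h1
          simpa using h2.sub_const (χ x' i)
        · filter_upwards [hev, hsrc] with s hs hss i
          have h0 : mfderiv 𝓘(ℝ, ℝ) (𝓡 n) c s (1 : ℝ) = 0 := by
            by_contra hne
            have h1 := G.pos (c s) _ hne
            rw [← G.length_sq, h.length_mfderiv hs, hd] at h1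
            simp at h1
          have h1 := h.hasDerivAt_chart hχ hs hss
          rw [h0, map_zero] at h1
          have h2 := ((EuclideanSpace.proj i : Eu n →L[ℝ] ℝ).hasFDerivAt.comp_hasDerivAt s h1)
          simpa using h2.sub_const (χ x' i)
      filter_upwards [hz, hsrc] with s hs hss
      refine χ.injOn hss hxs ?_
      ext i
      have := congrFun hs i
      simpa [sub_eq_zero] using this
  have := hsub (right_mem_Icc.2 zero_le_one)
  rw [mem_ofPred_eq, h.target] at this
  exact this

end IsMinimisingGeodesic

end Distance

/-! ### The gradient of the squared distance -/

section Gradient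

variable {n : ℕ} {X : Type*} [TopologicalSpace X] [ChartedSpace (Eu n) X] [IsManifold (𝓡 n) ∞ X]
  {χ : OpenPartialHomeomorph X (Eu n)} {x x' y : X}

/-- The value of the metric `G` at `y` on the vectors with components `v`, `w` in a chart. -/
def gramForm (G : Metric n X) (χ : OpenPartialHomeomorph X (Eu n)) (y : X) (v w : Eu n) : ℝ :=
  ∑ a, ∑ b, gram G χ y a b * v a * w b

lemma inner_eq_gramForm (G : Metric n X) (hχ : χ ∈ smoothCharts n X) (hx : x ∈ χ.source)
    (v w : TangentSpace (𝓡 n) x) :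
    G.inner x v w = gramForm G χ x (chartDiff χ x v) (chartDiff χ x w) :=
  inner_eq_sum_gram G hχ hx v w

lemma length_eq_gramForm (G : Metric n X) (hχ : χ ∈ smoothCharts n X) (hx : x ∈ χ.source)
    (v : TangentSpace (𝓡 n) x) :
    G.length v = Real.sqrt (gramForm G χ x (chartDiff χ x v) (chartDiff χ x v)) := by
  rw [Metric.length, inner_eq_gramForm G hχ hx]

lemma chartDiff_surjective (hχ : χ ∈ smoothCharts n X) (hx : x ∈ χ.source) :
    Function.Surjective (chartDiff χ x) := by
  obtain ⟨e, he⟩ := isInvertible_chartDiff hχ hx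
  rw [← he]
  exact e.surjective

/-- A function with a nonnegative right germ that vanishes at the point has nonnegative
derivative. -/
lemma deriv_nonneg_of_eventually_nonneg {h : ℝ → ℝ} {h' : ℝ} (hd : HasDerivAt h h' 0)
    (h0 : h 0 = 0) (hpos : ∀ᶠ r in 𝓝[>] 0, 0 ≤ h r) : 0 ≤ h' := by
  have h1 := (hasDerivAt_iff_tendsto_slope.1 hd).mono_left
    (nhdsWithin_mono (0 : ℝ) (show Ioi 0 ⊆ {0}ᶜ from fun r hr => ne_of_gt hr))
  refine ge_of_tendsto h1 ?_
  filter_upwards [hpos, self_mem_nhdsWithin] with r hr hr0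
  have hr0 : 0 < r := hr0
  simp only [slope, vsub_eq_sub, h0, sub_zero, smul_eq_mul]
  positivity

/-- The distance to `x'` is Lipschitz, hence `|dσ(v)| ≤ dist · |v|`. -/
lemma fderiv_sigma_le (G : Metric n X) (hχ : χ ∈ smoothCharts n X) (hy : y ∈ χ.source)
    (hfin : G.edist x' y ≠ ⊤)
    (hf : DifferentiableAt ℝ ((fun z => G.sigma z x') ∘ χ.symm) (χ y)) (v : Eu n) :
    fderiv ℝ ((fun z => G.sigma z x') ∘ χ.symm) (χ y) v
      ≤ G.dist y x' * Real.sqrt (gramForm G χ y v v) := by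
  set d := G.dist y x' with hd
  have hd0 : 0 ≤ d := G.dist_nonneg _ _
  set f := (fun z => G.sigma z x') ∘ χ.symm with hf'
  -- compare with the curve `η` that is straight in the chart, with velocity components `v`
  set η : ℝ → X := fun r => χ.symm (χ y + r • v) with hη
  have hη0 : η 0 = y := by simp [hη, χ.left_inv hy]
  have hline : Continuous fun r : ℝ => χ y + r • v := by fun_prop
  have hlin : ∀ r, HasDerivAt (fun r : ℝ => χ y + r • v) v r := fun r => by
    simpa using ((hasDerivAt_id r).smul_const v).const_add (χ y)
  have htgt : ∀ᶠ r in 𝓝 (0 : ℝ), χ y + r • v ∈ χ.target := by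
    refine hline.continuousAt.eventually_mem (χ.open_target.mem_nhds ?_)
    simpa using χ.map_source hy
  have hηc : ∀ r, χ y + r • v ∈ χ.target → ContMDiffAt 𝓘(ℝ, ℝ) (𝓡 n) ∞ η r := by
    intro r hr
    have h1 : ContMDiffAt 𝓘(ℝ, ℝ) (𝓡 n) ∞ (fun r : ℝ => χ y + r • v) r :=
      ContDiffAt.contMDiffAt (by fun_prop)
    exact (contMDiffAt_symm_of_mem_maximalAtlas hχ hr).comp r h1
  have hspeed : ∀ᶠ r in 𝓝 (0 : ℝ), G.length (mfderiv 𝓘(ℝ, ℝ) (𝓡 n) η r (1 : ℝ))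
      = Real.sqrt (gramForm G χ (η r) v v) := by
    filter_upwards [htgt.eventually_nhds] with r hr
    have hr0 := hr.self_of_nhds
    have hsrc : η r ∈ χ.source := χ.map_target hr0
    rw [length_eq_gramForm G hχ hsrc]
    have h1 := hasDerivAt_chart_comp hχ ((hηc r hr0).mdifferentiableAt (by simp)) hsrc
    have h2 : HasDerivAt (fun s => χ (η s)) v r := by
      refine (hlin r).congr_of_eventuallyEq ?_
      filter_upwards [hr] with s hs using χ.right_inv hs
    rw [h1.unique h2]
  have hcontη : ContinuousAt η 0 :=
    (hηc 0 htgt.self_of_nhds).continuousAt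
  have hcont : ContinuousAt (fun r => Real.sqrt (gramForm G χ (η r) v v)) 0 := by
    refine Real.continuous_sqrt.continuousAt.comp ?_
    unfold gramForm
    refine tendsto_finsetSum _ fun a _ => tendsto_finsetSum _ fun b _ => ?_
    have hg : ContinuousAt (fun z => gram G χ z a b) (η 0) := by
      rw [hη0]
      exact (contMDiffAt_gram G hχ hy a b).continuousAt
    exact ((ContinuousAt.comp (f := η) hg hcontη).tendsto.mul_const _).mul_const _
  have hfd : HasDerivAt (fun r : ℝ => f (χ y + r • v)) (fderiv ℝ f (χ y) v) 0 := by
    have h1 : HasFDerivAt f (fderiv ℝ f (χ y)) (χ y + (0 : ℝ) • v) := by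
      simpa using hf.hasFDerivAt
    exact h1.comp_hasDerivAt 0 (hlin 0)
  -- it suffices to bound the derivative with the speed increased by an arbitrary `ε`
  refine le_of_forall_pos_le_add fun ε' hε' => ?_
  obtain ⟨ε, hε, hεd⟩ : ∃ ε > 0, d * ε ≤ ε' :=
    ⟨ε' / (d + 1), by positivity, by
      rw [mul_div_assoc', div_le_iff₀ (by positivity)]
      nlinarith⟩
  set K := Real.sqrt (gramForm G χ y v v) + ε with hK
  have hK0 : 0 ≤ K := by positivity
  have hlt : ∀ᶠ r in 𝓝 (0 : ℝ), Real.sqrt (gramForm G χ (η r) v v) < K := by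
    refine hcont.eventually_lt_const ?_
    change Real.sqrt (gramForm G χ (η 0) v v) < K
    rw [hη0, hK]
    linarith
  obtain ⟨δ, hδ, hδ'⟩ := Metric.eventually_nhds_iff.1 (htgt.and (hspeed.and hlt))
  have hpos : ∀ᶠ r in 𝓝[>] (0 : ℝ), 0 ≤ (d + K * r) ^ 2 / 2 - f (χ y + r • v) := by
    filter_upwards [Ioo_mem_nhdsGT hδ] with r hr
    have hmem : ∀ s ∈ Icc 0 r, Dist.dist s 0 < δ := fun s hs => by
      rw [Real.dist_eq, sub_zero, abs_of_nonneg hs.1]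
      exact hs.2.trans_lt hr.2
    have h1 : G.edist (η 0) (η r) ≤ ENNReal.ofReal (K * (r - 0)) := by
      refine G.edist_le_of_length_le hr.1.le hK0 (fun s hs => ?_) fun s hs => ?_
      · exact ((hηc s (hδ' (hmem s hs)).1).of_le (by simp)).contMDiffWithinAt
      · obtain ⟨-, h2, h3⟩ := hδ' (hmem s ⟨hs.1.le, hs.2.le⟩)
        rw [h2]
        exact h3.le
    rw [hη0, sub_zero] at h1
    have h2 : G.dist (η r) x' ≤ d + K * r := by
      have hf1 : G.edist y x' ≠ ⊤ := by rwa [G.edist_comm]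
      calc G.dist (η r) x' ≤ (G.edist y (η r) + G.edist y x').toReal := by
            rw [Metric.dist_eq]
            refine ENNReal.toReal_mono
              (ENNReal.add_ne_top.2 ⟨ne_top_of_le_ne_top ENNReal.ofReal_ne_top h1, hf1⟩) ?_
            rw [G.edist_comm y (η r)]
            exact G.edist_triangle _ _ _
        _ = (G.edist y (η r)).toReal + d :=
            ENNReal.toReal_add (ne_top_of_le_ne_top ENNReal.ofReal_ne_top h1) hf1
        _ ≤ K * r + d := by
            gcongr
            exact ENNReal.toReal_le_of_le_ofReal (mul_nonneg hK0 hr.1.le) h1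
        _ = d + K * r := add_comm _ _
    have h3 : f (χ y + r • v) = G.dist (η r) x' ^ 2 / 2 := rfl
    rw [h3, sub_nonneg]
    have := G.dist_nonneg (η r) x'
    gcongr
  have hder : HasDerivAt (fun r : ℝ => (d + K * r) ^ 2 / 2 - f (χ y + r • v))
      (d * K - fderiv ℝ f (χ y) v) 0 := by
    have h1 : HasDerivAt (fun r : ℝ => (d + K * r) ^ 2 / 2) (d * K) 0 := by
      refine (((((hasDerivAt_id' (0 : ℝ)).const_mul K).const_add d).fun_pow 2).div_const
        2).congr_deriv ?_
      norm_num
      ring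
    exact h1.sub hfd
  have h0 : (d + K * 0) ^ 2 / 2 - f (χ y + (0 : ℝ) • v) = 0 := by
    have : f (χ y) = d ^ 2 / 2 := by simp [hf', χ.left_inv hy, Metric.sigma, hd]
    simp [this]
  have := deriv_nonneg_of_eventually_nonneg hder h0 hpos
  calc fderiv ℝ f (χ y) v ≤ d * K := by linarith
    _ = d * Real.sqrt (gramForm G χ y v v) + d * ε := by rw [hK]; ring
    _ ≤ _ := by linarith

lemma abs_fderiv_sigma_le (G : Metric n X) (hχ : χ ∈ smoothCharts n X) (hy : y ∈ χ.source)
    (hfin : G.edist x' y ≠ ⊤)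
    (hf : DifferentiableAt ℝ ((fun z => G.sigma z x') ∘ χ.symm) (χ y)) (v : Eu n) :
    |fderiv ℝ ((fun z => G.sigma z x') ∘ χ.symm) (χ y) v|
      ≤ G.dist y x' * Real.sqrt (gramForm G χ y v v) := by
  rw [abs_le]
  refine ⟨?_, fderiv_sigma_le G hχ hy hfin hf v⟩
  have h := fderiv_sigma_le G hχ hy hfin hf (-v)
  have h2 : gramForm G χ y (-v) (-v) = gramForm G χ y v v := by simp [gramForm]
  rw [map_neg, h2] at h
  linarith

/-- `dσ` vanishes on the diagonal. -/
lemma pd_sigma_self (G : Metric n X) (hχ : χ ∈ smoothCharts n X) (hx : x ∈ χ.source)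
    (hf : DifferentiableAt ℝ ((fun z => G.sigma z x) ∘ χ.symm) (χ x)) (a : Fin n) :
    pd χ a (fun z => G.sigma z x) x = 0 := by
  have := abs_fderiv_sigma_le G hχ hx (by simp [G.edist_self]) hf (EuclideanSpace.single a 1)
  rw [G.dist_self, zero_mul] at this
  exact abs_eq_zero.1 (le_antisymm this (abs_nonneg _))

/-- If a linear form `ω` on an inner product space has norm at most `t d`, and `ω(w) = t d²` for a
vector `w` of length `d`, then `ω = t ⟨w, ·⟩`. This is stated for the value of `ω` at one vector `v`,
with `p = ⟨w, v⟩` and `q = ⟨v, v⟩`; the hypothesis `h` is the bound for `ω(w + r v)`, squared. -/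
lemma eq_mul_of_extremal {t d ωv p q : ℝ} (ht : 0 < t) (hd : 0 ≤ d)
    (hp : d = 0 → p = 0) (hω : d = 0 → ωv = 0)
    (h : ∀ r : ℝ, (t * d ^ 2 + r * ωv) ^ 2 ≤ (t * d) ^ 2 * (d ^ 2 + 2 * r * p + r ^ 2 * q)) :
    ωv = t * p := by
  rcases hd.eq_or_lt with h0 | hd
  · rw [hp h0.symm, hω h0.symm, mul_zero]
  have key : ∀ r : ℝ, 0 ≤ r * (2 * t * d ^ 2 * (t * p - ωv) + r * ((t * d) ^ 2 * q - ωv ^ 2)) :=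
    fun r => by nlinarith [h r]
  set A := 2 * t * d ^ 2 * (t * p - ωv) with hA
  set B := (t * d) ^ 2 * q - ωv ^ 2
  -- a function `r (A + r B)` that is nonnegative for all `r` has `A = 0`
  have hA0 : A = 0 := by
    by_contra hne
    have h1 := key (-A / (|B| + 1))
    have hB : 0 < |B| + 1 := by positivity
    have h2 : -A / (|B| + 1) * (A + -A / (|B| + 1) * B)
        = -(A ^ 2 * (|B| + 1 - B)) / (|B| + 1) ^ 2 := by
      field_simp
      ring
    rw [h2] at h1
    have h3 : 0 < A ^ 2 * (|B| + 1 - B) :=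
      mul_pos (by positivity) (by linarith [le_abs_self B])
    have h4 : -(A ^ 2 * (|B| + 1 - B)) / (|B| + 1) ^ 2 < 0 :=
      div_neg_of_neg_of_pos (by linarith) (by positivity)
    linarith
  have : t * p - ωv = 0 := by
    have h1 : 2 * t * d ^ 2 ≠ 0 := by positivity
    exact (mul_eq_zero.1 hA0).resolve_left h1
  linarith

/-- The gradient of `σ(·, x')` at the point `c(t)` of a minimising geodesic `c` from `x'` is
`t c'(t)`. No variational formula enters: `dσ` has norm at most the distance to `x'`, and this bound
is attained on `c'(t)`. -/
lemma IsMinimisingGeodesic.pd_sigma {G : Metric n X} {c : ℝ → X}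
    (h : IsMinimisingGeodesic G x' x c) (hχ : χ ∈ smoothCharts n X) {t : ℝ}
    (ht : t ∈ Ioo (0 : ℝ) 1) (hx : c t ∈ χ.source)
    (hf : DifferentiableAt ℝ ((fun z => G.sigma z x') ∘ χ.symm) (χ (c t))) (b : Fin n) :
    pd χ b (fun z => G.sigma z x') (c t)
      = ∑ a, gram G χ (c t) b a
          * (t * chartDiff χ (c t) (mfderiv 𝓘(ℝ, ℝ) (𝓡 n) c t (1 : ℝ)) a) := by
  set f := (fun z => G.sigma z x') ∘ χ.symm with hf'
  set T := mfderiv 𝓘(ℝ, ℝ) (𝓡 n) c t (1 : ℝ) with hT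
  set w : Eu n := chartDiff χ (c t) T with hw
  set d := G.dist x' x with hd
  have hd0 : 0 ≤ d := G.dist_nonneg _ _
  have ht' : t ∈ Icc (0 : ℝ) 1 := ⟨ht.1.le, ht.2.le⟩
  set v : Eu n := EuclideanSpace.single b 1 with hv
  obtain ⟨V, hV⟩ := chartDiff_surjective hχ hx v
  have hlen : gramForm G χ (c t) w w = d ^ 2 := by
    rw [← inner_eq_gramForm G hχ hx, ← G.length_sq, h.length_mfderiv ht]
  -- the derivative of `σ` along the geodesic, from `σ(c(s), x') = s² d² / 2`
  have hfw : fderiv ℝ f (χ (c t)) w = t * d ^ 2 := by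
    have h1 : HasDerivAt (fun s => f (χ (c s))) (fderiv ℝ f (χ (c t)) w) t :=
      hf.hasFDerivAt.comp_hasDerivAt t (h.hasDerivAt_chart hχ ht hx)
    have h2 : HasDerivAt (fun s : ℝ => (s * d) ^ 2 / 2) (t * d ^ 2) t := by
      refine ((((hasDerivAt_id' t).mul_const d).fun_pow 2).div_const 2).congr_deriv ?_
      norm_num
      ring
    refine h1.unique (h2.congr_of_eventuallyEq ?_)
    filter_upwards [Ioo_mem_nhds ht.1 ht.2, (h.contMDiffAt ht).continuousAt.eventually_mem
      (χ.open_source.mem_nhds hx)] with s hs hss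
    simp only [hf', Function.comp_apply, χ.left_inv hss, Metric.sigma]
    rw [G.dist_comm, h.dist_eq ⟨hs.1.le, hs.2.le⟩]
  have hdist : G.dist (c t) x' = t * d := by rw [G.dist_comm, h.dist_eq ht']
  have hbound := abs_fderiv_sigma_le G hχ hx (h.edist_ne_top ht') hf
  rw [hdist] at hbound
  have hgoal : fderiv ℝ f (χ (c t)) v = t * G.inner (c t) T V := by
    refine eq_mul_of_extremal (d := d) (q := G.inner (c t) V V) ht.1 hd0 ?_ ?_ ?_
    · intro h0
      have hT0 : T = 0 := by
        by_contra hne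
        have h1 := G.pos (c t) T hne
        rw [← G.length_sq, h.length_mfderiv ht, ← hd, h0] at h1
        simp at h1
      simp [hT0]
    · intro h0
      have := hbound v
      rw [h0, mul_zero, zero_mul] at this
      exact abs_eq_zero.1 (le_antisymm this (abs_nonneg _))
    · intro r
      have h1 := hbound (w + r • v)
      have h2 : gramForm G χ (c t) (w + r • v) (w + r • v)
          = d ^ 2 + 2 * r * G.inner (c t) T V + r ^ 2 * G.inner (c t) V V := by
        have h3 : w + r • v = chartDiff χ (c t) (T + r • V) := by
          rw [map_add, map_smul, hV]
        rw [h3, ← inner_eq_gramForm G hχ hx, ← hlen, hw, ← inner_eq_gramForm G hχ hx]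
        simp only [map_add, map_smul, _root_.add_apply, _root_.smul_apply, smul_eq_mul,
          G.symm (c t) V T]
        ring
      have h4 : 0 ≤ gramForm G χ (c t) (w + r • v) (w + r • v) := by
        have h3 : w + r • v = chartDiff χ (c t) (T + r • V) := by
          rw [map_add, map_smul, hV]
        rw [h3, ← inner_eq_gramForm G hχ hx]
        exact G.inner_self_nonneg _
      rw [map_add, map_smul, hfw, smul_eq_mul] at h1
      calc (t * d ^ 2 + r * fderiv ℝ f (χ (c t)) v) ^ 2
          ≤ (t * d * Real.sqrt (gramForm G χ (c t) (w + r • v) (w + r • v))) ^ 2 := by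
            rw [← sq_abs]
            gcongr
        _ = _ := by rw [mul_pow, Real.sq_sqrt h4, h2]
  change fderiv ℝ f (χ (c t)) v = _
  rw [hgoal, inner_eq_gramForm G hχ hx, hV, ← hw, gramForm, Finset.mul_sum]
  refine Finset.sum_congr rfl fun a _ => ?_
  rw [Finset.sum_eq_single b]
  · rw [gram_symm G a b, hv]
    simp
    ring
  · intro k _ hk
    simp [hv, hk]
  · simp

end Gradient

/-! ### Smoothness of the squared distance on a convex geodesic neighbourhood -/

section Sigma

variable {n : ℕ} {X : Type*} [TopologicalSpace X] [ChartedSpace (Eu n) X] [IsManifold (𝓡 n) ∞ X]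
  {χ : OpenPartialHomeomorph X (Eu n)} {x x' y : X} {G : Metric n X} {O : Set X}

lemma IsMinimisingGeodesic.mdifferentiableWithinAt_zero {c : ℝ → X}
    (h : IsMinimisingGeodesic G x' x c) :
    MDifferentiableWithinAt 𝓘(ℝ, ℝ) (𝓡 n) c (Icc 0 1) 0 :=
  (h.smooth 0 ⟨le_rfl, zero_le_one⟩).mdifferentiableWithinAt (by simp)

/-- The squared distance is the squared length of the initial velocity of the minimising geodesic,
computed in a chart at its initial point. -/
lemma IsMinimisingGeodesic.sigma_eq {c : ℝ → X} (h : IsMinimisingGeodesic G x' x c)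
    (hχ : χ ∈ smoothCharts n X) (hx' : x' ∈ χ.source) :
    G.sigma x' x = 1 / 2 * gramForm G χ x'
      (mfderivWithin 𝓘(ℝ, ℝ) (𝓡 n) (fun t => χ (c t)) (Icc 0 1) 0 (1 : ℝ))
      (mfderivWithin 𝓘(ℝ, ℝ) (𝓡 n) (fun t => χ (c t)) (Icc 0 1) 0 (1 : ℝ)) := by
  have hu : UniqueMDiffWithinAt 𝓘(ℝ, ℝ) (Icc (0 : ℝ) 1) 0 :=
    (uniqueDiffOn_Icc zero_lt_one 0 ⟨le_rfl, zero_le_one⟩).uniqueMDiffWithinAt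
  have hcs : c 0 ∈ χ.source := by rwa [h.source]
  have h1 : mfderivWithin 𝓘(ℝ, ℝ) (𝓡 n) (fun t => χ (c t)) (Icc 0 1) 0
      = (chartDiff χ (c 0)).comp (mfderivWithin 𝓘(ℝ, ℝ) (𝓡 n) c (Icc 0 1) 0) :=
    mfderiv_comp_mfderivWithin (0 : ℝ) (g := χ)
      ((contMDiffAt_of_mem_maximalAtlas hχ hcs).mdifferentiableAt (by simp))
      h.mdifferentiableWithinAt_zero hu
  have h2 := h.speed 0 ⟨le_rfl, zero_le_one⟩
  have h3 : gramForm G χ (c 0)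
      (mfderivWithin 𝓘(ℝ, ℝ) (𝓡 n) (fun t => χ (c t)) (Icc 0 1) 0 (1 : ℝ))
      (mfderivWithin 𝓘(ℝ, ℝ) (𝓡 n) (fun t => χ (c t)) (Icc 0 1) 0 (1 : ℝ))
      = G.dist x' x ^ 2 := by
    rw [h1, ← h2, G.length_sq, inner_eq_gramForm G hχ hcs]
    rfl
  rw [← h.source, h3, h.source, Metric.sigma]
  ring

/-- The initial velocity of the geodesic from `x'` to `x` depends smoothly on `(x', x)`, hence so
does half its square, which is `σ`. -/
lemma IsConvexGeodesic.contMDiffOn_sigma (hO : IsConvexGeodesic G O) :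
    ContMDiffOn ((𝓡 n).prod (𝓡 n)) 𝓘(ℝ, ℝ) ∞ (fun p : X × X => G.sigma p.1 p.2) (O ×ˢ O) := by
  obtain ⟨hOo, c, hc, hsm⟩ := hO
  rintro ⟨x', x⟩ ⟨hx', hx⟩
  set χ := chartAt (Eu n) x'
  have hχ : χ ∈ smoothCharts n X := IsManifold.chart_mem_maximalAtlas x'
  have hxs : x' ∈ χ.source := mem_chart_source _ x'
  have h0 : (0 : ℝ) ∈ Icc (0 : ℝ) 1 := ⟨le_rfl, zero_le_one⟩
  have hc0 : c x' x 0 = x' := (hc x' hx' x hx).1.source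
  have hfam : ContMDiffWithinAt (((𝓡 n).prod (𝓡 n)).prod 𝓘(ℝ, ℝ)) (𝓡 n) ∞
      (Function.uncurry fun (p : X × X) (t : ℝ) => χ (c p.1 p.2 t))
      ((O ×ˢ O) ×ˢ Icc (0 : ℝ) 1) ((x', x), 0) := by
    have h1 := hsm ((x', x), 0) ⟨⟨hx', hx⟩, h0⟩
    refine ContMDiffAt.comp_contMDiffWithinAt (g := χ) ((x', x), (0 : ℝ)) ?_ h1
    exact contMDiffAt_of_mem_maximalAtlas hχ (by simpa [hc0] using hxs)
  have hder := ContMDiffWithinAt.mfderivWithin (m := ∞) (g := fun _ : X × X => (0 : ℝ)) hfam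
    contMDiffWithinAt_const ⟨hx', hx⟩ (fun _ _ => h0) (by simp)
    (uniqueDiffOn_Icc zero_lt_one).uniqueMDiffOn
  let L : X × X → ℝ →L[ℝ] Eu n := fun p =>
    mfderivWithin 𝓘(ℝ, ℝ) (𝓡 n) (fun t => χ (c p.1 p.2 t)) (Icc 0 1) (0 : ℝ)
  have hL : ContMDiffWithinAt ((𝓡 n).prod (𝓡 n)) 𝓘(ℝ, ℝ →L[ℝ] Eu n) ∞ L (O ×ˢ O) (x', x) := by
    have he : inTangentCoordinates 𝓘(ℝ, ℝ) (𝓡 n) (fun _ : X × X => (0 : ℝ))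
        (fun p : X × X => χ (c p.1 p.2 0)) L (x', x) = L :=
      inTangentCoordinates_model_space (I := 𝓘(ℝ, ℝ)) (I' := 𝓡 n) _ _ _ _
    rw [← he]
    exact hder
  set w : X × X → Eu n := fun p =>
    mfderivWithin 𝓘(ℝ, ℝ) (𝓡 n) (fun t => χ (c p.1 p.2 t)) (Icc 0 1) 0 (1 : ℝ) with hw
  have hwsm : ContMDiffWithinAt ((𝓡 n).prod (𝓡 n)) (𝓡 n) ∞ w (O ×ˢ O) (x', x) :=
    hL.clm_apply contMDiffWithinAt_const
  have hwi : ∀ i, ContMDiffWithinAt ((𝓡 n).prod (𝓡 n)) 𝓘(ℝ, ℝ) ∞ (fun p => w p i) (O ×ˢ O)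
      (x', x) := fun i =>
    (EuclideanSpace.proj i : Eu n →L[ℝ] ℝ).contMDiff.contMDiffAt.comp_contMDiffWithinAt _ hwsm
  have hform : ContMDiffWithinAt ((𝓡 n).prod (𝓡 n)) 𝓘(ℝ, ℝ) ∞
      (fun p : X × X => 1 / 2 * gramForm G χ p.1 (w p) (w p)) (O ×ˢ O) (x', x) := by
    unfold gramForm
    refine contMDiffWithinAt_const.mul (ContMDiffWithinAt.sum fun a _ =>
      ContMDiffWithinAt.sum fun b _ => ?_)
    refine ((ContMDiffWithinAt.mul ?_ (hwi a)).mul (hwi b))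
    exact ContMDiffAt.comp_contMDiffWithinAt (g := fun z => gram G χ z a b) (x', x)
      (contMDiffAt_gram G hχ hxs a b) contMDiffWithinAt_fst
  refine hform.congr_of_eventuallyEq_of_mem ?_ ⟨hx', hx⟩
  have hev : ∀ᶠ p : X × X in 𝓝[O ×ˢ O] (x', x), p.1 ∈ χ.source :=
    (continuous_fst.tendsto (x', x)).mono_left nhdsWithin_le_nhds
      (χ.open_source.mem_nhds hxs)
  filter_upwards [hev, self_mem_nhdsWithin] with p hp hpO
  exact (hc p.1 hpO.1 p.2 hpO.2).1.sigma_eq hχ hp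

lemma IsConvexGeodesic.contMDiffAt_sigma (hO : IsConvexGeodesic G O) (hy : y ∈ O) (hx' : x' ∈ O) :
    ContMDiffAt (𝓡 n) 𝓘(ℝ, ℝ) ∞ (fun z => G.sigma z x') y := by
  have h1 : ContMDiffAt ((𝓡 n).prod (𝓡 n)) 𝓘(ℝ, ℝ) ∞ (fun p : X × X => G.sigma p.1 p.2) (y, x') :=
    hO.contMDiffOn_sigma.contMDiffAt ((hO.1.prod hO.1).mem_nhds ⟨hy, hx'⟩)
  exact h1.comp y (f := fun z => (z, x')) (contMDiffAt_id.prodMk contMDiffAt_const)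

lemma contDiffAt_comp_symm (hχ : χ ∈ smoothCharts n X) (hy : y ∈ χ.source) {f : X → ℝ}
    (hf : ContMDiffAt (𝓡 n) 𝓘(ℝ, ℝ) ∞ f y) : ContDiffAt ℝ ∞ (f ∘ χ.symm) (χ y) := by
  refine (ContMDiffAt.comp (χ y) ?_
    (contMDiffAt_symm_of_mem_maximalAtlas hχ (χ.map_source hy))).contDiffAt
  rwa [χ.left_inv hy]

lemma differentiableAt_comp_symm (hχ : χ ∈ smoothCharts n X) (hy : y ∈ χ.source) {f : X → ℝ}
    (hf : ContMDiffAt (𝓡 n) 𝓘(ℝ, ℝ) ∞ f y) : DifferentiableAt ℝ (f ∘ χ.symm) (χ y) :=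
  (contDiffAt_comp_symm hχ hy hf).differentiableAt (by simp)

lemma IsConvexGeodesic.tendsto_sigma (hO : IsConvexGeodesic G O) (hx : x ∈ O) :
    Tendsto (fun p : X × X => G.sigma p.1 p.2) (𝓝 (x, x)) (𝓝 0) := by
  have hmem : O ×ˢ O ∈ 𝓝 (x, x) := (hO.1.prod hO.1).mem_nhds ⟨hx, hx⟩
  have h := (hO.contMDiffOn_sigma.contMDiffAt hmem).continuousAt.tendsto
  simpa [G.sigma_self] using h

lemma IsConvexGeodesic.sigma_pos [T2Space X] (hO : IsConvexGeodesic G O) (hx : x ∈ O)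
    (hx' : x' ∈ O) (hne : x ≠ x') : 0 < G.sigma x x' := by
  obtain ⟨-, c, hc, -⟩ := hO
  have h1 : G.dist x x' ≠ 0 := fun h0 =>
    hne ((hc x hx x' hx').1.eq_of_dist_eq_zero h0).symm
  unfold Metric.sigma
  positivity

end Sigma

/-! ### Components of bitensors -/

section Components

variable {D : ℕ}
  {S : Type*} [TopologicalSpace S] [ChartedSpace (Eu 2) S] [IsManifold (𝓡 2) ∞ S]
  {M : Type*} [TopologicalSpace M] [ChartedSpace (Eu D) M] [IsManifold (𝓡 D) ∞ M]
  {χ χ' : OpenPartialHomeomorph M (Eu D)} {y y' : M}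

lemma comp_add (T U : TangentSpace (𝓡 D) y ⊗[ℝ] TangentSpace (𝓡 D) y') (i j : Fin D) :
    comp χ χ' (T + U) i j = comp χ χ' T i j + comp χ χ' U i j := by
  simp only [comp, map_add]

lemma comp_sub (T U : TangentSpace (𝓡 D) y ⊗[ℝ] TangentSpace (𝓡 D) y') (i j : Fin D) :
    comp χ χ' (T - U) i j = comp χ χ' T i j - comp χ χ' U i j := by
  simp only [comp, map_sub]

lemma comp_smul (r : ℝ) (T : TangentSpace (𝓡 D) y ⊗[ℝ] TangentSpace (𝓡 D) y') (i j : Fin D) :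
    comp χ χ' (r • T) i j = r * comp χ χ' T i j := by
  simp only [comp, map_smul, smul_eq_mul]

lemma comp_tmul (v : TangentSpace (𝓡 D) y) (w : TangentSpace (𝓡 D) y') (i j : Fin D) :
    comp χ χ' (v ⊗ₜ[ℝ] w) i j = chartDiff χ y v i * chartDiff χ' y' w j := rfl

lemma eq_sum_comp (hχ : χ ∈ smoothCharts D M) (hy : y ∈ χ.source) (hχ' : χ' ∈ smoothCharts D M)
    (hy' : y' ∈ χ'.source) (T : TangentSpace (𝓡 D) y ⊗[ℝ] TangentSpace (𝓡 D) y') :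
    T = ∑ i, ∑ j, comp χ χ' T i j • (coordVec χ y i ⊗ₜ[ℝ] coordVec χ' y' j) := by
  induction T with
  | zero => simp [comp]
  | add T U hT hU =>
    simp only [comp_add, add_smul, Finset.sum_add_distrib]
    rw [← hT, ← hU]
  | tmul v w =>
    conv_lhs => rw [eq_sum_coordVec hχ hy v, eq_sum_coordVec hχ' hy' w]
    simp only [TensorProduct.sum_tmul, TensorProduct.tmul_sum, TensorProduct.smul_tmul_smul,
      comp_tmul]
    rw [Finset.sum_comm]

lemma eq_of_comp_eq (hχ : χ ∈ smoothCharts D M) (hy : y ∈ χ.source) (hχ' : χ' ∈ smoothCharts D M)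
    (hy' : y' ∈ χ'.source) {T U : TangentSpace (𝓡 D) y ⊗[ℝ] TangentSpace (𝓡 D) y'}
    (h : ∀ i j, comp χ χ' T i j = comp χ χ' U i j) : T = U := by
  rw [eq_sum_comp hχ hy hχ' hy' T, eq_sum_comp hχ hy hχ' hy' U]
  simp only [h]

lemma inverseMetric_ne_zero (hD : 0 < D) (G : Metric D M) (y : M) : inverseMetric G y ≠ 0 := by
  set e : Fin D → TangentSpace (𝓡 D) y := fun a => (EuclideanSpace.single a (1 : ℝ) : Eu D) with he
  set A : Matrix (Fin D) (Fin D) ℝ := Matrix.of fun i j => G.inner y (e i) (e j) with hA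
  have hdet : IsUnit A.det := isUnit_det_of_inner G fun v hv => by
    ext a
    have h1 : (∑ a, v a • (EuclideanSpace.single a (1 : ℝ) : Eu D)) a = 0 := by
      have h2 : ∑ a, v a • (EuclideanSpace.single a (1 : ℝ) : Eu D) = 0 := hv
      rw [h2]
      rfl
    simpa [Pi.single_apply] using h1
  -- contracting the inverse metric with the metric gives the dimension
  let B : TangentSpace (𝓡 D) y →ₗ[ℝ] TangentSpace (𝓡 D) y →ₗ[ℝ] ℝ :=
    LinearMap.mk₂ ℝ (fun v w => G.inner y v w) (by simp) (by simp) (by simp) (by simp)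
  have htr : TensorProduct.lift B (inverseMetric G y) = D := by
    have h1 : inverseMetric G y = ∑ a, ∑ b, A⁻¹ a b • (e a ⊗ₜ[ℝ] e b) := rfl
    have h2 : ∀ a b, B (e a) (e b) = A b a := fun a b => G.symm y _ _
    rw [h1]
    simp only [map_sum, map_smul, TensorProduct.lift.tmul, h2, smul_eq_mul]
    calc ∑ a, ∑ b, A⁻¹ a b * A b a = Matrix.trace (A⁻¹ * A) := rfl
      _ = D := by rw [Matrix.nonsing_inv_mul _ hdet, Matrix.trace_one, Fintype.card_fin]
  intro h0
  rw [h0, map_zero] at htr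
  exact hD.ne' (by exact_mod_cast htr.symm)

variable {ψ : S → M} {O : Set S} {T : Bitensor D ψ}

lemma SmoothBitensorOn.contMDiffAt (hO : IsOpen O) (hψ : Continuous ψ) (hT : SmoothBitensorOn O T)
    (hχ : χ ∈ smoothCharts D M) (hχ' : χ' ∈ smoothCharts D M) {x x' : S} (hx : x ∈ O) (hx' : x' ∈ O)
    (hxs : ψ x ∈ χ.source) (hxs' : ψ x' ∈ χ'.source) (i j : Fin D) :
    ContMDiffAt ((𝓡 2).prod (𝓡 2)) 𝓘(ℝ, ℝ) ∞ (fun p : S × S => comp χ χ' (T p.1 p.2) i j)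
      (x, x') := by
  refine (hT χ hχ χ' hχ' i j).contMDiffAt ?_
  refine inter_mem ((hO.prod hO).mem_nhds ⟨hx, hx'⟩) ?_
  have h1 : ContinuousAt (fun p : S × S => ψ p.1) (x, x') := (hψ.comp continuous_fst).continuousAt
  have h2 : ContinuousAt (fun p : S × S => ψ p.2) (x, x') := (hψ.comp continuous_snd).continuousAt
  exact inter_mem (h1 (χ.open_source.mem_nhds hxs)) (h2 (χ'.open_source.mem_nhds hxs'))

lemma SmoothBitensorOn.contMDiffAt_left (hO : IsOpen O) (hψ : Continuous ψ)
    (hT : SmoothBitensorOn O T)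
    (hχ : χ ∈ smoothCharts D M) (hχ' : χ' ∈ smoothCharts D M) {x x' : S} (hx : x ∈ O) (hx' : x' ∈ O)
    (hxs : ψ x ∈ χ.source) (hxs' : ψ x' ∈ χ'.source) (i j : Fin D) :
    ContMDiffAt (𝓡 2) 𝓘(ℝ, ℝ) ∞ (fun z => comp χ χ' (T z x') i j) x :=
  (hT.contMDiffAt hO hψ hχ hχ' hx hx' hxs hxs' i j).comp x (f := fun z => (z, x'))
    (contMDiffAt_id.prodMk contMDiffAt_const)

end Components

/-! ### Covariant derivatives along minimising geodesics -/

section Transport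

variable {D : ℕ}
  {S : Type*} [TopologicalSpace S] [ChartedSpace (Eu 2) S] [IsManifold (𝓡 2) ∞ S]
  {M : Type*} [TopologicalSpace M] [ChartedSpace (Eu D) M] [IsManifold (𝓡 D) ∞ M]
  {b : Background D S M} {φ : OpenPartialHomeomorph S (Eu 2)}
  {χ χ' : OpenPartialHomeomorph M (Eu D)} {O : Set S}

/-- The matrix `v^α (dψ)^l_α Γⁱ_{lk}(ψ)` by which the pull-back connection in the direction with
components `v` differs from the derivative of the components. -/
def connForm (b : Background D S M) (φ : OpenPartialHomeomorph S (Eu 2))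
    (χ : OpenPartialHomeomorph M (Eu D)) (v : Eu 2) (i k : Fin D) (x : S) : ℝ :=
  ∑ α, v α * ∑ l, dpsi b φ χ l α x * christoffel b.g χ i l k (b.ψ x)

lemma sum_mul_nabla (u : S → Fin D → ℝ) (v : Eu 2) (i : Fin D) (x : S) :
    ∑ α, v α * nabla b φ χ u α i x
      = ∑ α, v α * pd φ α (fun y => u y i) x + ∑ k, connForm b φ χ v i k x * u x k := by
  simp only [nabla, mul_add, Finset.sum_add_distrib, connForm, Finset.sum_mul, Finset.mul_sum]
  congr 1
  rw [Finset.sum_comm (γ := Fin D)]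
  refine Finset.sum_congr rfl fun α _ => ?_
  rw [Finset.sum_comm]
  exact Finset.sum_congr rfl fun k _ => Finset.sum_congr rfl fun l _ => by ring

lemma hasDerivAt_comp_curve (hφ : φ ∈ smoothCharts 2 S) {c : ℝ → S} {t : ℝ} {v : Eu 2}
    (hc : ContinuousAt c t) (hct : c t ∈ φ.source) (hv : HasDerivAt (fun s => φ (c s)) v t)
    {f : S → ℝ} (hf : ContMDiffAt (𝓡 2) 𝓘(ℝ, ℝ) ∞ f (c t)) :
    HasDerivAt (fun s => f (c s)) (∑ α, v α * pd φ α f (c t)) t := by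
  have h1 := (differentiableAt_comp_symm hφ hct hf).hasFDerivAt.comp_hasDerivAt t hv
  have h2 : fderiv ℝ (f ∘ φ.symm) (φ (c t)) v = ∑ α, v α * pd φ α f (c t) := by
    have h3 : v = ∑ α, v α • (EuclideanSpace.single α (1 : ℝ) : Eu 2) := by
      ext i
      fin_cases i <;> simp
    conv_lhs => rw [h3]
    simp only [map_sum, map_smul, smul_eq_mul]
    rfl
  rw [← h2]
  refine h1.congr_of_eventuallyEq ?_
  filter_upwards [hc.eventually_mem (φ.open_source.mem_nhds hct)] with s hs
  simp [φ.left_inv hs]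

/-- Along a minimising geodesic `c` from `x'`, the derivative of a section in the direction of the
gradient of `σ(·, x')` is `t` times the covariant derivative along `c`. -/
lemma nablaAlong_sigma {x' x : S} {c : ℝ → S} (h : IsMinimisingGeodesic b.γ x' x c)
    (hφ : φ ∈ smoothCharts 2 S) {t : ℝ} (ht : t ∈ Ioo (0 : ℝ) 1) (hct : c t ∈ φ.source)
    (hf : ContMDiffAt (𝓡 2) 𝓘(ℝ, ℝ) ∞ (fun z => b.γ.sigma z x') (c t)) (u : S → Fin D → ℝ)
    (a : Fin D) :
    nablaAlong b φ χ u (fun z => b.γ.sigma z x') a (c t)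
      = ∑ i, gram b.g χ (b.ψ (c t)) a i * (t * ∑ α,
          chartDiff φ (c t) (mfderiv 𝓘(ℝ, ℝ) (𝓡 2) c t (1 : ℝ)) α * nabla b φ χ u α i (c t)) := by
  set v : Eu 2 := chartDiff φ (c t) (mfderiv 𝓘(ℝ, ℝ) (𝓡 2) c t (1 : ℝ)) with hv
  have hpd := fun β => h.pd_sigma hφ ht hct (differentiableAt_comp_symm hφ hct hf) β
  have hgrad : ∀ α, ∑ β, gramInv b.γ φ (c t) α β * pd φ β (fun z => b.γ.sigma z x') (c t)
      = t * v α := by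
    intro α
    simp_rw [hpd]
    exact sum_gramInv_mul_gram b.γ hφ hct (fun β => t * v β) α
  unfold nablaAlong
  refine Finset.sum_congr rfl fun i _ => ?_
  rw [Finset.mul_sum, Finset.mul_sum]
  refine Finset.sum_congr rfl fun α _ => ?_
  calc _ = gram b.g χ (b.ψ (c t)) a i * nabla b φ χ u α i (c t)
        * ∑ β, gramInv b.γ φ (c t) α β * pd φ β (fun z => b.γ.sigma z x') (c t) := by
        rw [Finset.mul_sum]
        exact Finset.sum_congr rfl fun β _ => by ring
    _ = _ := by
        rw [hgrad]
        ring

lemma nablaAlong_sigma_self (hO : IsConvexGeodesic b.γ O) {x : S} (hx : x ∈ O)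
    (hφ : φ ∈ smoothCharts 2 S) (hxs : x ∈ φ.source) (u : S → Fin D → ℝ) (a : Fin D) :
    nablaAlong b φ χ u (fun z => b.γ.sigma z x) a x = 0 := by
  have h := fun β => pd_sigma_self b.γ hφ hxs
    (differentiableAt_comp_symm hφ hxs (hO.contMDiffAt_sigma hx hx)) β
  simp only [nablaAlong, h, mul_zero, Finset.sum_const_zero]

/-- The velocity of a minimising geodesic is bounded in charts, near the endpoints too. -/
lemma IsMinimisingGeodesic.isBigO_velocity {G : Metric 2 S} {x' x : S} {c : ℝ → S}
    (h : IsMinimisingGeodesic G x' x c) (hφ : φ ∈ smoothCharts 2 S) {t₀ : ℝ}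
    (ht₀ : t₀ ∈ Ico (0 : ℝ) 1) (hct : c t₀ ∈ φ.source) :
    (fun t => chartDiff φ (c t) (mfderiv 𝓘(ℝ, ℝ) (𝓡 2) c t (1 : ℝ)))
      =O[𝓝[>] t₀] fun _ => (1 : ℝ) := by
  have h1 : ContMDiffWithinAt 𝓘(ℝ, ℝ) (𝓡 2) ∞ (fun t => φ (c t)) (Icc 0 1) t₀ :=
    ContMDiffAt.comp_contMDiffWithinAt (g := φ) t₀ (contMDiffAt_of_mem_maximalAtlas hφ hct)
      (h.smooth t₀ ⟨ht₀.1, ht₀.2.le⟩)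
  have h2 : ContDiffWithinAt ℝ 1 (fun t => φ (c t)) (Icc 0 1) t₀ :=
    h1.contDiffWithinAt.of_le (by simp)
  obtain ⟨K, u, hu, hK⟩ := h2.exists_lipschitzOnWith (convex_Icc 0 1)
  have hev : ∀ᶠ t in 𝓝[Icc 0 1] t₀, c t ∈ φ.source :=
    (h.smooth t₀ ⟨ht₀.1, ht₀.2.le⟩).continuousWithinAt (φ.open_source.mem_nhds hct)
  have hle : 𝓝[>] t₀ ≤ 𝓝[Icc 0 1] t₀ := by
    rw [← nhdsWithin_Ioo_eq_nhdsGT ht₀.2]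
    exact nhdsWithin_mono _ fun s hs => ⟨ht₀.1.trans hs.1.le, hs.2.le⟩
  obtain ⟨w, hw, hwu⟩ := mem_nhdsGT_iff_exists_Ioo_subset.1 (hle hu)
  refine Asymptotics.IsBigO.of_bound K ?_
  filter_upwards [hle hev, Ioo_mem_nhdsGT hw, Ioo_mem_nhdsGT ht₀.2] with t ht htw ht1
  have h3 := h.hasDerivAt_chart hφ ⟨ht₀.1.trans_lt ht1.1, ht1.2⟩ ht
  have := h3.le_of_lipschitzOn (mem_of_superset (Ioo_mem_nhds htw.1 htw.2) hwu) hK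
  simpa using this

end Transport

/-! ### Uniqueness for the transport equations -/

section Uniqueness

variable {D : ℕ}
  {S : Type*} [TopologicalSpace S] [ChartedSpace (Eu 2) S] [IsManifold (𝓡 2) ∞ S]
  {M : Type*} [TopologicalSpace M] [ChartedSpace (Eu D) M] [IsManifold (𝓡 D) ∞ M]
  {b : Background D S M} {φ : OpenPartialHomeomorph S (Eu 2)}
  {χ χ' : OpenPartialHomeomorph M (Eu D)} {O : Set S}

lemma Background.continuous_ψ (b : Background D S M) : Continuous b.ψ := b.smooth_ψ.continuous

lemma contMDiffAt_dpsi (b : Background D S M) (hφ : φ ∈ smoothCharts 2 S)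
    (hχ : χ ∈ smoothCharts D M) {y : S} (hy : y ∈ φ.source) (hψ : b.ψ y ∈ χ.source) (l : Fin D)
    (α : Fin 2) : ContMDiffAt (𝓡 2) 𝓘(ℝ, ℝ) ∞ (dpsi b φ χ l α) y := by
  refine contMDiffAt_pd hφ hy ?_ α
  have h1 : ContMDiffAt (𝓡 2) (𝓡 D) ∞ (fun z => χ (b.ψ z)) y :=
    (contMDiffAt_of_mem_maximalAtlas hχ hψ).comp y (b.smooth_ψ y)
  exact (EuclideanSpace.proj l : Eu D →L[ℝ] ℝ).contMDiff.contMDiffAt.comp y h1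

variable {U₁ U₂ : Bitensor D b.ψ} {x x' : S} {c : ℝ → S}

lemma IsMinimisingGeodesic.tendsto_nhdsGT {G : Metric 2 S} (h : IsMinimisingGeodesic G x' x c) {t₀ : ℝ}
    (ht₀ : t₀ ∈ Ico (0 : ℝ) 1) : Tendsto c (𝓝[>] t₀) (𝓝 (c t₀)) := by
  have hle : 𝓝[>] t₀ ≤ 𝓝[Icc 0 1] t₀ := by
    rw [← nhdsWithin_Ioo_eq_nhdsGT ht₀.2]
    exact nhdsWithin_mono _ fun s hs => ⟨ht₀.1.trans hs.1.le, hs.2.le⟩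
  exact (h.smooth t₀ ⟨ht₀.1, ht₀.2.le⟩).continuousWithinAt.mono_left hle

lemma isBigO_connForm (h : IsMinimisingGeodesic b.γ x' x c) (hφ : φ ∈ smoothCharts 2 S)
    (hχ : χ ∈ smoothCharts D M) {t₀ : ℝ} (ht₀ : t₀ ∈ Ico (0 : ℝ) 1) (hct : c t₀ ∈ φ.source)
    (hψ : b.ψ (c t₀) ∈ χ.source) (i k : Fin D) :
    (fun t => connForm b φ χ (chartDiff φ (c t) (mfderiv 𝓘(ℝ, ℝ) (𝓡 2) c t (1 : ℝ))) i k (c t))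
      =O[𝓝[>] t₀] fun _ => (1 : ℝ) := by
  have hc := h.tendsto_nhdsGT ht₀
  unfold connForm
  refine Asymptotics.IsBigO.fun_sum fun α _ => ?_
  have h1 : (fun t => chartDiff φ (c t) (mfderiv 𝓘(ℝ, ℝ) (𝓡 2) c t (1 : ℝ)) α)
      =O[𝓝[>] t₀] fun _ => (1 : ℝ) := by
    refine Asymptotics.IsBigO.trans ?_ (h.isBigO_velocity hφ ht₀ hct)
    exact Asymptotics.isBigO_of_le _ fun t =>
      PiLp.norm_apply_le (chartDiff φ (c t) (mfderiv 𝓘(ℝ, ℝ) (𝓡 2) c t (1 : ℝ))) α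
  have h2 : (fun t => ∑ l, dpsi b φ χ l α (c t) * christoffel b.g χ i l k (b.ψ (c t)))
      =O[𝓝[>] t₀] fun _ => (1 : ℝ) := by
    refine Asymptotics.IsBigO.fun_sum fun l _ => ?_
    have h3 := ((contMDiffAt_dpsi b hφ hχ hct hψ l α).continuousAt.tendsto.comp hc)
    have h4 := ((contMDiffAt_christoffel b.g hχ hψ i l k).continuousAt.tendsto.comp
      ((b.continuous_ψ.tendsto _).comp hc))
    exact (h3.mul h4).isBigO_one ℝ
  simpa using h1.mul h2

/-- The zeroth order coefficient of the transport equation along a geodesic, divided by the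
parameter, is bounded: it vanishes at the parameter `0`. -/
lemma isBigO_laplacian_div (hO : IsConvexGeodesic b.γ O) (h : IsMinimisingGeodesic b.γ x' x c)
    (hcO : ∀ t ∈ Icc (0 : ℝ) 1, c t ∈ O) (hφ : φ ∈ smoothCharts 2 S) {t₀ : ℝ}
    (ht₀ : t₀ ∈ Ico (0 : ℝ) 1) (hct : c t₀ ∈ φ.source)
    (hΔ : x' ∈ φ.source → laplacian b.γ φ (fun z => b.γ.sigma z x') x' = 2) :
    (fun t => (laplacian b.γ φ (fun z => b.γ.sigma z x') (c t) - 2) / (2 * t))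
      =O[𝓝[>] t₀] fun _ => (1 : ℝ) := by
  set L := laplacian b.γ φ (fun z => b.γ.sigma z x') with hL
  have hx' : x' ∈ O := h.source ▸ hcO 0 ⟨le_rfl, zero_le_one⟩
  have hLs : ContMDiffAt (𝓡 2) 𝓘(ℝ, ℝ) ∞ L (c t₀) :=
    contMDiffAt_laplacian b.γ hφ hct (hO.contMDiffAt_sigma (hcO t₀ ⟨ht₀.1, ht₀.2.le⟩) hx')
  rcases ht₀.1.eq_or_lt with h0 | hpos
  · subst h0
    rw [h.source] at hct
    have h1 : ContMDiffWithinAt 𝓘(ℝ, ℝ) 𝓘(ℝ, ℝ) ∞ (fun t => L (c t)) (Icc 0 1) 0 :=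
      ContMDiffAt.comp_contMDiffWithinAt (g := L) (0 : ℝ) hLs (h.smooth 0 ⟨le_rfl, zero_le_one⟩)
    have h2 : DifferentiableWithinAt ℝ (fun t => L (c t)) (Icc 0 1) 0 :=
      h1.contDiffWithinAt.differentiableWithinAt (by simp)
    have h3 := h2.hasDerivWithinAt.hasFDerivWithinAt.isBigO_sub
    have hle : 𝓝[>] (0 : ℝ) ≤ 𝓝[Icc 0 1] 0 := by
      rw [← nhdsWithin_Ioo_eq_nhdsGT (zero_lt_one (α := ℝ))]
      exact nhdsWithin_mono _ Ioo_subset_Icc_self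
    have h4 : (fun t => L (c t) - 2) =O[𝓝[>] (0 : ℝ)] fun t => t := by
      have := h3.mono hle
      simpa [h.source, hΔ hct] using this
    obtain ⟨C, hC⟩ := h4.bound
    refine Asymptotics.IsBigO.of_bound (C / 2) ?_
    filter_upwards [hC, self_mem_nhdsWithin] with t ht htpos
    have htpos : 0 < t := htpos
    rw [norm_div, Real.norm_of_nonneg (by positivity : (0 : ℝ) ≤ 2 * t), norm_one, mul_one,
      div_le_iff₀ (by positivity)]
    rw [Real.norm_of_nonneg htpos.le] at ht
    linarith
  · have h1 : Tendsto (fun t => L (c t)) (𝓝[>] t₀) (𝓝 (L (c t₀))) :=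
      hLs.continuousAt.tendsto.comp (h.tendsto_nhdsGT ht₀)
    have h2 : Tendsto (fun t : ℝ => 2 * t) (𝓝[>] t₀) (𝓝 (2 * t₀)) :=
      ((continuous_const.mul continuous_id).tendsto t₀).mono_left nhdsWithin_le_nhds
    exact ((h1.sub_const 2).div h2 (by positivity)).isBigO_one ℝ

/-- In terms of `w = u₁ - u₂`, two solutions of the same transport equation satisfy
`2 t w' = -2 t A w - (Δσ - 2 + 2 n) w` along a geodesic, `A` being the connection form. -/
lemma transport_ode (hO : IsConvexGeodesic b.γ O) (h : IsMinimisingGeodesic b.γ x' x c)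
    (hcO : ∀ t ∈ Icc (0 : ℝ) 1, c t ∈ O) (hφ : φ ∈ smoothCharts 2 S) (hχ : χ ∈ smoothCharts D M)
    {t : ℝ} (ht : t ∈ Ioo (0 : ℝ) 1) (hct : c t ∈ φ.source) (hψ : b.ψ (c t) ∈ χ.source)
    {u₁ u₂ : S → Fin D → ℝ} {p : ℝ}
    (hT : ∀ a, 2 * nablaAlong b φ χ u₁ (fun z => b.γ.sigma z x') a (c t)
        + (∑ i, gram b.g χ (b.ψ (c t)) a i * u₁ (c t) i) * p
      = 2 * nablaAlong b φ χ u₂ (fun z => b.γ.sigma z x') a (c t)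
        + (∑ i, gram b.g χ (b.ψ (c t)) a i * u₂ (c t) i) * p) (i : Fin D) :
    2 * t * ((∑ α, chartDiff φ (c t) (mfderiv 𝓘(ℝ, ℝ) (𝓡 2) c t (1 : ℝ)) α
          * pd φ α (fun y => u₁ y i) (c t)
        - ∑ α, chartDiff φ (c t) (mfderiv 𝓘(ℝ, ℝ) (𝓡 2) c t (1 : ℝ)) α
          * pd φ α (fun y => u₂ y i) (c t))
        + ∑ k, connForm b φ χ (chartDiff φ (c t) (mfderiv 𝓘(ℝ, ℝ) (𝓡 2) c t (1 : ℝ))) i k (c t)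
          * (u₁ (c t) k - u₂ (c t) k))
      + (u₁ (c t) i - u₂ (c t) i) * p = 0 := by
  have hx' : x' ∈ O := h.source ▸ hcO 0 ⟨le_rfl, zero_le_one⟩
  have hσ := hO.contMDiffAt_sigma (hcO t ⟨ht.1.le, ht.2.le⟩) hx'
  set v : Eu 2 := chartDiff φ (c t) (mfderiv 𝓘(ℝ, ℝ) (𝓡 2) c t (1 : ℝ)) with hv
  have hX := sum_gram_mul_eq_zero b.g hχ hψ (v := fun i =>
    2 * (t * ∑ α, v α * nabla b φ χ u₁ α i (c t)) + u₁ (c t) i * p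
      - (2 * (t * ∑ α, v α * nabla b φ χ u₂ α i (c t)) + u₂ (c t) i * p)) fun a => by
    have h1 := hT a
    rw [nablaAlong_sigma h hφ ht hct hσ, nablaAlong_sigma h hφ ht hct hσ] at h1
    rw [← sub_eq_zero] at h1
    rw [← h1]
    simp only [Finset.mul_sum, Finset.sum_mul, ← Finset.sum_add_distrib, ← Finset.sum_sub_distrib,
      mul_add, mul_sub]
    refine Finset.sum_congr rfl fun i _ => ?_
    simp only [Fin.sum_univ_two]
    ring
  have hXi := congrFun hX i
  simp only [sum_mul_nabla, Pi.zero_apply] at hXi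
  simp only [mul_sub, Finset.sum_sub_distrib]
  linarith

/-- Two solutions of the same transport equation that agree at a point of a geodesic issuing from
`x'` agree on the geodesic for a while. For `n > 0` the equation is singular at the parameter `0`;
multiplying the difference by `tⁿ` makes it regular. -/
lemma transport_eventually_eq (hO : IsConvexGeodesic b.γ O)
    (h : IsMinimisingGeodesic b.γ x' x c) (hcO : ∀ t ∈ Icc (0 : ℝ) 1, c t ∈ O)
    (hU₁ : SmoothBitensorOn O U₁) (hU₂ : SmoothBitensorOn O U₂) (n : ℕ)
    (hΔ : ∀ φ ∈ smoothCharts 2 S, x' ∈ φ.source →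
      laplacian b.γ φ (fun z => b.γ.sigma z x') x' = 2)
    (hT : ∀ φ ∈ smoothCharts 2 S, ∀ χ ∈ smoothCharts D M, ∀ χ' ∈ smoothCharts D M,
      ∀ y ∈ O, y ∈ φ.source → b.ψ y ∈ χ.source → b.ψ x' ∈ χ'.source → ∀ a j,
      2 * nablaAlong b φ χ (fun y i => comp χ χ' (U₁ y x') i j) (fun z => b.γ.sigma z x') a y
        + (∑ i, gram b.g χ (b.ψ y) a i * comp χ χ' (U₁ y x') i j)
          * (laplacian b.γ φ (fun z => b.γ.sigma z x') y - 2 + 2 * n)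
      = 2 * nablaAlong b φ χ (fun y i => comp χ χ' (U₂ y x') i j) (fun z => b.γ.sigma z x') a y
        + (∑ i, gram b.g χ (b.ψ y) a i * comp χ χ' (U₂ y x') i j)
          * (laplacian b.γ φ (fun z => b.γ.sigma z x') y - 2 + 2 * n))
    {t₀ : ℝ} (ht₀ : t₀ ∈ Ico (0 : ℝ) 1) (hz : U₁ (c t₀) x' = U₂ (c t₀) x') :
    ∀ᶠ t in 𝓝[>] t₀, U₁ (c t) x' = U₂ (c t) x' := by
  have hx' : x' ∈ O := h.source ▸ hcO 0 ⟨le_rfl, zero_le_one⟩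
  set φ := chartAt (Eu 2) (c t₀)
  set χ := chartAt (Eu D) (b.ψ (c t₀))
  set χ' := chartAt (Eu D) (b.ψ x')
  have hφ : φ ∈ smoothCharts 2 S := IsManifold.chart_mem_maximalAtlas _
  have hχ : χ ∈ smoothCharts D M := IsManifold.chart_mem_maximalAtlas _
  have hχ' : χ' ∈ smoothCharts D M := IsManifold.chart_mem_maximalAtlas _
  have hct : c t₀ ∈ φ.source := mem_chart_source _ _
  have hψ : b.ψ (c t₀) ∈ χ.source := mem_chart_source _ _
  have hψ' : b.ψ x' ∈ χ'.source := mem_chart_source _ _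
  have hc := h.tendsto_nhdsGT ht₀
  have hev : ∀ᶠ t in 𝓝[>] t₀, t ∈ Ioo (0 : ℝ) 1 ∧ c t ∈ φ.source ∧ b.ψ (c t) ∈ χ.source := by
    filter_upwards [Ioo_mem_nhdsGT ht₀.2, hc (φ.open_source.mem_nhds hct),
      ((b.continuous_ψ.tendsto _).comp hc) (χ.open_source.mem_nhds hψ)] with t h1 h2 h3
    exact ⟨⟨ht₀.1.trans_lt h1.1, h1.2⟩, h2, h3⟩
  set w : Fin D → ℝ → Fin D → ℝ := fun j t i =>
    comp χ χ' (U₁ (c t) x') i j - comp χ χ' (U₂ (c t) x') i j with hw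
  set L := laplacian b.γ φ (fun z => b.γ.sigma z x') with hL
  -- the components of `tⁿ w` solve a linear system with bounded coefficients
  have hmain : ∀ j, ∀ᶠ t in 𝓝[>] t₀, t ^ n • w j t = 0 := by
    intro j
    refine eventually_eq_zero_of_linear_ode (B := fun i k t =>
      -connForm b φ χ (chartDiff φ (c t) (mfderiv 𝓘(ℝ, ℝ) (𝓡 2) c t (1 : ℝ))) i k (c t)
        - if i = k then (L (c t) - 2) / (2 * t) else 0) ?_ ?_ ?_
    · rw [tendsto_pi_nhds]
      intro i
      have hcO₀ := hcO t₀ ⟨ht₀.1, ht₀.2.le⟩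
      have h1 := (hU₁.contMDiffAt_left hO.1 b.continuous_ψ hχ hχ' hcO₀ hx' hψ hψ' i j
        ).continuousAt.tendsto.comp hc
      have h2 := (hU₂.contMDiffAt_left hO.1 b.continuous_ψ hχ hχ' hcO₀ hx' hψ hψ' i j
        ).continuousAt.tendsto.comp hc
      have h3 : Tendsto (fun t : ℝ => t ^ n) (𝓝[>] t₀) (𝓝 (t₀ ^ n)) :=
        ((continuous_pow n).tendsto t₀).mono_left nhdsWithin_le_nhds
      have h4 := h3.mul (h1.sub h2)
      simpa [hz] using h4
    · intro i k
      refine (isBigO_connForm h hφ hχ ht₀ hct hψ i k).neg_left.sub ?_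
      by_cases hik : i = k
      · simpa [hik] using isBigO_laplacian_div hO h hcO hφ ht₀ hct (hΔ φ hφ)
      · simp only [hik, if_false]
        exact Asymptotics.isBigO_zero _ _
    · filter_upwards [hev] with t ⟨ht, hts, htψ⟩ i
      have hcOt := hcO t ⟨ht.1.le, ht.2.le⟩
      have hode := transport_ode hO h hcO hφ hχ ht hts htψ
        (fun a => hT φ hφ χ hχ χ' hχ' (c t) hcOt hts htψ hψ' a j) i
      have hcc := (h.contMDiffAt ht).continuousAt
      have hv := h.hasDerivAt_chart hφ ht hts
      have hd₁ := hasDerivAt_comp_curve hφ hcc hts hv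
        (hU₁.contMDiffAt_left hO.1 b.continuous_ψ hχ hχ' hcOt hx' htψ hψ' i j)
      have hd₂ := hasDerivAt_comp_curve hφ hcc hts hv
        (hU₂.contMDiffAt_left hO.1 b.continuous_ψ hχ hχ' hcOt hx' htψ hψ' i j)
      have hd := (hasDerivAt_pow n t).mul (hd₁.sub hd₂)
      refine hd.congr_deriv ?_
      have hpow : (n : ℝ) * t ^ (n - 1) * t = n * t ^ n := by
        cases n with
        | zero => simp
        | succ m => rw [Nat.add_sub_cancel, pow_succ, mul_assoc]
      have ht0 : t ≠ 0 := ht.1.ne'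
      simp only [sub_mul, neg_mul, ite_mul, zero_mul, Finset.sum_sub_distrib, Finset.sum_neg_distrib,
        Finset.sum_ite_eq, Finset.mem_univ, if_true, Pi.smul_apply, Pi.sub_apply, smul_eq_mul, hw]
      have hsum : ∑ k, connForm b φ χ (chartDiff φ (c t) (mfderiv 𝓘(ℝ, ℝ) (𝓡 2) c t (1 : ℝ))) i k
            (c t) * (t ^ n * (comp χ χ' (U₁ (c t) x') k j - comp χ χ' (U₂ (c t) x') k j))
          = t ^ n * ∑ k, connForm b φ χ
            (chartDiff φ (c t) (mfderiv 𝓘(ℝ, ℝ) (𝓡 2) c t (1 : ℝ))) i k (c t)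
              * (comp χ χ' (U₁ (c t) x') k j - comp χ χ' (U₂ (c t) x') k j) := by
        rw [Finset.mul_sum]
        exact Finset.sum_congr rfl fun k _ => by ring
      rw [hsum]
      refine mul_left_cancel₀ (mul_ne_zero two_ne_zero ht0) ?_
      field_simp
      linear_combination (2 * (comp χ χ' (U₁ (c t) x') i j - comp χ χ' (U₂ (c t) x') i j)) * hpow
        + t ^ n * hode
  filter_upwards [eventually_all.2 hmain, hev] with t ht ⟨ht01, _, htψ⟩
  refine eq_of_comp_eq hχ htψ hχ' hψ' fun i j => ?_
  have h1 := congrFun (ht j) i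
  have h2 : t ^ n ≠ 0 := pow_ne_zero n ht01.1.ne'
  simpa [h2, hw, sub_eq_zero] using h1

/-- Two smooth solutions of the same transport equation that agree on the diagonal agree. -/
lemma transport_unique (hO : IsConvexGeodesic b.γ O)
    (hU₁ : SmoothBitensorOn O U₁) (hU₂ : SmoothBitensorOn O U₂) (n : ℕ) (hx' : x' ∈ O)
    (hΔ : ∀ φ ∈ smoothCharts 2 S, x' ∈ φ.source →
      laplacian b.γ φ (fun z => b.γ.sigma z x') x' = 2)
    (hT : ∀ φ ∈ smoothCharts 2 S, ∀ χ ∈ smoothCharts D M, ∀ χ' ∈ smoothCharts D M,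
      ∀ y ∈ O, y ∈ φ.source → b.ψ y ∈ χ.source → b.ψ x' ∈ χ'.source → ∀ a j,
      2 * nablaAlong b φ χ (fun y i => comp χ χ' (U₁ y x') i j) (fun z => b.γ.sigma z x') a y
        + (∑ i, gram b.g χ (b.ψ y) a i * comp χ χ' (U₁ y x') i j)
          * (laplacian b.γ φ (fun z => b.γ.sigma z x') y - 2 + 2 * n)
      = 2 * nablaAlong b φ χ (fun y i => comp χ χ' (U₂ y x') i j) (fun z => b.γ.sigma z x') a y
        + (∑ i, gram b.g χ (b.ψ y) a i * comp χ χ' (U₂ y x') i j)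
          * (laplacian b.γ φ (fun z => b.γ.sigma z x') y - 2 + 2 * n))
    (hinit : U₁ x' x' = U₂ x' x') (hx : x ∈ O) : U₁ x x' = U₂ x x' := by
  obtain ⟨c, hc, -⟩ := hO.2
  obtain ⟨h, hcO, -⟩ := hc x' hx' x hx
  have hsub : Icc (0 : ℝ) 1 ⊆ {t | U₁ (c x' x t) x' = U₂ (c x' x t) x'} := by
    refine IsClosed.Icc_subset_of_forall_mem_nhdsWithin ?_ ?_ ?_
    · rw [isClosed_iff_frequently]
      intro t ht
      have htI : t ∈ Icc (0 : ℝ) 1 :=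
        isClosed_Icc.mem_of_frequently_of_tendsto (ht.mono fun s hs => hs.2) tendsto_id
      refine ⟨?_, htI⟩
      have hχ : chartAt (Eu D) (b.ψ (c x' x t)) ∈ smoothCharts D M :=
        IsManifold.chart_mem_maximalAtlas _
      have hχ' : chartAt (Eu D) (b.ψ x') ∈ smoothCharts D M := IsManifold.chart_mem_maximalAtlas _
      refine eq_of_comp_eq hχ (mem_chart_source _ _) hχ' (mem_chart_source _ _) fun i j => ?_
      have hcw := (h.smooth t htI).continuousWithinAt.tendsto
      have h1 := (hU₁.contMDiffAt_left hO.1 b.continuous_ψ hχ hχ' (hcO t htI) hx'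
        (mem_chart_source _ _) (mem_chart_source _ _) i j).continuousAt.tendsto.comp hcw
      have h2 := (hU₂.contMDiffAt_left hO.1 b.continuous_ψ hχ hχ' (hcO t htI) hx'
        (mem_chart_source _ _) (mem_chart_source _ _) i j).continuousAt.tendsto.comp hcw
      by_contra hne
      have h3 := (h1.sub h2).eventually_ne (sub_ne_zero.2 hne)
      rw [eventually_nhdsWithin_iff] at h3
      obtain ⟨s, hs, hs'⟩ := (ht.and_eventually h3).exists
      refine hs' hs.2 ?_
      have h4 : U₁ (c x' x s) x' = U₂ (c x' x s) x' := hs.1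
      simp [h4]
    · change U₁ (c x' x 0) x' = U₂ (c x' x 0) x'
      rw [h.source, hinit]
    · rintro t ⟨ht, htI⟩
      exact transport_eventually_eq hO h hcO hU₁ hU₂ n hΔ hT htI ht
  have := hsub (right_mem_Icc.2 zero_le_one)
  rwa [mem_ofPred_eq, h.target] at this

end Uniqueness

/-! ### Uniqueness of the Hadamard coefficients -/

section Coefficients

variable {D : ℕ}
  {S : Type*} [TopologicalSpace S] [ChartedSpace (Eu 2) S] [IsManifold (𝓡 2) ∞ S]
  {M : Type*} [TopologicalSpace M] [ChartedSpace (Eu D) M] [IsManifold (𝓡 D) ∞ M]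
  {b : Background D S M} {φ : OpenPartialHomeomorph S (Eu 2)}
  {χ χ' : OpenPartialHomeomorph M (Eu D)} {O : Set S}

lemma pd_eventuallyEq {n : ℕ} {X : Type*} [TopologicalSpace X] [ChartedSpace (Eu n) X]
    {χ : OpenPartialHomeomorph X (Eu n)} {x : X} (hx : x ∈ χ.source) {f g : X → ℝ}
    (h : f =ᶠ[𝓝 x] g) (a : Fin n) : pd χ a f =ᶠ[𝓝 x] pd χ a g := by
  filter_upwards [h.eventually_nhds, χ.open_source.mem_nhds hx] with y hy hys
  have h1 : f ∘ χ.symm =ᶠ[𝓝 (χ y)] g ∘ χ.symm := by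
    have h2 := (χ.continuousAt_symm (χ.map_source hys)).tendsto
    rw [χ.left_inv hys] at h2
    exact h2.eventually hy
  simp only [pd, h1.fderiv_eq]

lemma nabla_eventuallyEq {x : S} (hx : x ∈ φ.source) {u₁ u₂ : S → Fin D → ℝ}
    (h : ∀ᶠ y in 𝓝 x, u₁ y = u₂ y) (α : Fin 2) (i : Fin D) :
    nabla b φ χ u₁ α i =ᶠ[𝓝 x] nabla b φ χ u₂ α i := by
  have h1 : (fun y => u₁ y i) =ᶠ[𝓝 x] fun y => u₂ y i := h.mono fun y hy => congrFun hy i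
  filter_upwards [h, pd_eventuallyEq hx h1 α] with y hy hy'
  simp only [nabla, hy, hy']

lemma opE_congr {x : S} (hx : x ∈ φ.source) {u₁ u₂ : S → Fin D → ℝ}
    (h : ∀ᶠ y in 𝓝 x, u₁ y = u₂ y) (a : Fin D) : opE b φ χ u₁ a x = opE b φ χ u₂ a x := by
  have h1 := fun α i => nabla_eventuallyEq (b := b) (χ := χ) hx h α i
  have h2 := fun α β i => (pd_eventuallyEq hx (h1 β i) α).self_of_nhds
  have h3 := fun α i => (h1 α i).self_of_nhds
  simp only [opE, nabla2, h2, h3]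

variable {V V' : ℕ → Bitensor D b.ψ}

/-- The value of `Δσ` on the diagonal, read off from the transport equation for `V₀` and the
invertibility of `V₀` there. -/
lemma IsHadamardSeq.laplacian_sigma_self (hO : IsConvexGeodesic b.γ O) (hV : IsHadamardSeq b O V)
    (hD : 0 < D) {x : S} (hx : x ∈ O) (hφ : φ ∈ smoothCharts 2 S) (hxs : x ∈ φ.source) :
    laplacian b.γ φ (fun z => b.γ.sigma z x) x = 2 := by
  set χ := chartAt (Eu D) (b.ψ x)
  have hχ : χ ∈ smoothCharts D M := IsManifold.chart_mem_maximalAtlas _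
  have hψ : b.ψ x ∈ χ.source := mem_chart_source _ _
  by_contra hne
  refine inverseMetric_ne_zero hD b.g (b.ψ x) ?_
  rw [← hV.init x hx]
  refine eq_of_comp_eq hχ hψ hχ hψ fun i j => ?_
  have h1 := sum_gram_mul_eq_zero b.g hχ hψ (v := fun i => comp χ χ (V 0 x x) i j) fun a => by
    have h2 := hV.transport_zero φ hφ χ hχ χ hχ x hx x hx hxs hψ hψ a j
    rw [nablaAlong_sigma_self hO hx hφ hxs, mul_zero, zero_add] at h2
    exact (mul_eq_zero.1 h2).resolve_right (sub_ne_zero.2 hne)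
  rw [congrFun h1 i]
  simp [comp]

/-- The Hadamard coefficients are determined by the background. -/
theorem IsHadamardSeq.unique (hO : IsConvexGeodesic b.γ O) (hV : IsHadamardSeq b O V)
    (hV' : IsHadamardSeq b O V') (n : ℕ) :
    ∀ x ∈ O, ∀ x' ∈ O, V n x x' = V' n x x' := by
  -- for `D = 0` there are no nonzero bitensors, and the equations say nothing about `Δσ`
  rcases Nat.eq_zero_or_pos D with hD | hD
  · subst hD
    intro x _ x' _
    exact eq_of_comp_eq (IsManifold.chart_mem_maximalAtlas _) (mem_chart_source _ _)
      (IsManifold.chart_mem_maximalAtlas _) (mem_chart_source _ _) fun i => i.elim0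
  have hΔ : ∀ x' ∈ O, ∀ φ ∈ smoothCharts 2 S, x' ∈ φ.source →
      laplacian b.γ φ (fun z => b.γ.sigma z x') x' = 2 :=
    fun x' hx' φ hφ hxs => hV.laplacian_sigma_self hO hD hx' hφ hxs
  induction n with
  | zero =>
    intro x hx x' hx'
    refine transport_unique hO (hV.smooth 0) (hV'.smooth 0) 0 hx' (hΔ x' hx') ?_ ?_ hx
    · intro φ hφ χ hχ χ' hχ' y hy hys hψ hψ' a j
      have h1 := hV.transport_zero φ hφ χ hχ χ' hχ' y hy x' hx' hys hψ hψ' a j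
      have h2 := hV'.transport_zero φ hφ χ hχ χ' hχ' y hy x' hx' hys hψ hψ' a j
      simp only [Nat.cast_zero, mul_zero, add_zero]
      rw [h1, h2]
    · rw [hV.init x' hx', hV'.init x' hx']
  | succ n ih =>
    intro x hx x' hx'
    have hE : ∀ φ : OpenPartialHomeomorph S (Eu 2), ∀ χ χ' : OpenPartialHomeomorph M (Eu D),
        ∀ y ∈ O, y ∈ φ.source → ∀ a j,
        opE b φ χ (fun y i => comp χ χ' (V n y x') i j) a y
          = opE b φ χ (fun y i => comp χ χ' (V' n y x') i j) a y := by
      intro φ χ χ' y hy hys a j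
      refine opE_congr hys ?_ a
      filter_upwards [hO.1.mem_nhds hy] with z hz
      rw [ih z hz x' hx']
    have hpos : ((n + 1 : ℕ) : ℝ) ≠ 0 := Nat.cast_ne_zero.2 n.succ_ne_zero
    refine transport_unique hO (hV.smooth _) (hV'.smooth _) (n + 1) hx' (hΔ x' hx') ?_ ?_ hx
    · intro φ hφ χ hχ χ' hχ' y hy hys hψ hψ' a j
      have h1 := hV.transport_pos (n + 1) (by omega) φ hφ χ hχ χ' hχ' y hy x' hx' hys hψ hψ' a j
      have h2 := hV'.transport_pos (n + 1) (by omega) φ hφ χ hχ χ' hχ' y hy x' hx' hys hψ hψ' a j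
      rw [Nat.add_sub_cancel] at h1 h2
      rw [hE φ χ χ' y hy hys a j] at h1
      refine mul_left_cancel₀ hpos ?_
      linear_combination h1 - h2
    -- on the diagonal the equation is algebraic: `E V_n + 2 (n + 1)² V_{n+1} = 0`
    · set φ := chartAt (Eu 2) x'
      set χ := chartAt (Eu D) (b.ψ x')
      have hφ : φ ∈ smoothCharts 2 S := IsManifold.chart_mem_maximalAtlas _
      have hχ : χ ∈ smoothCharts D M := IsManifold.chart_mem_maximalAtlas _
      have hxs : x' ∈ φ.source := mem_chart_source _ _
      have hψ : b.ψ x' ∈ χ.source := mem_chart_source _ _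
      refine eq_of_comp_eq hχ hψ hχ hψ fun i j => ?_
      have h0 := sum_gram_mul_eq_zero b.g hχ hψ (v := fun i =>
        comp χ χ (V (n + 1) x' x') i j - comp χ χ (V' (n + 1) x' x') i j) fun a => by
        have h1 := hV.transport_pos (n + 1) (by omega) φ hφ χ hχ χ hχ x' hx' x' hx' hxs hψ hψ a j
        have h2 := hV'.transport_pos (n + 1) (by omega) φ hφ χ hχ χ hχ x' hx' x' hx' hxs hψ hψ a j
        rw [Nat.add_sub_cancel, nablaAlong_sigma_self hO hx' hφ hxs, hΔ x' hx' φ hφ hxs] at h1 h2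
        rw [hE φ χ χ x' hx' hxs a j] at h1
        simp only [mul_sub, Finset.sum_sub_distrib]
        refine mul_left_cancel₀ (mul_ne_zero two_ne_zero (mul_ne_zero hpos hpos)) ?_
        linear_combination h1 - h2
      exact sub_eq_zero.1 (congrFun h0 i)

/-! ### Behaviour under rescaling -/

lemma pd_const_mul {n : ℕ} {X : Type*} [TopologicalSpace X] [ChartedSpace (Eu n) X]
    (χ : OpenPartialHomeomorph X (Eu n)) (a : Fin n) (r : ℝ) (f : X → ℝ) (x : X) :
    pd χ a (fun y => r * f y) x = r * pd χ a f x := by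
  have h : (fun y => r * f y) ∘ χ.symm = r • (f ∘ χ.symm) := rfl
  rw [pd, h, fderiv_const_smul_field]
  rfl

section ScaleMetric

variable {n : ℕ} {X : Type*} [TopologicalSpace X] [ChartedSpace (Eu n) X] [IsManifold (𝓡 n) ∞ X]
  {χ : OpenPartialHomeomorph X (Eu n)} {x : X} (G : Metric n X) {r : ℝ} (hr : 0 < r)

lemma gram_scale (χ : OpenPartialHomeomorph X (Eu n)) (x : X) (a b : Fin n) :
    gram (G.scale r hr) χ x a b = r * gram G χ x a b := rfl

lemma gramInv_scale (hχ : χ ∈ smoothCharts n X) (hx : x ∈ χ.source) (a b : Fin n) :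
    gramInv (G.scale r hr) χ x a b = r⁻¹ * gramInv G χ x a b := by
  have h : gram (G.scale r hr) χ x = Units.mk0 r hr.ne' • gram G χ x := rfl
  rw [gramInv, h, Matrix.inv_smul' _ (Units.mk0 r hr.ne') (isUnit_det_gram G hχ hx)]
  rfl

lemma christoffel_scale (hχ : χ ∈ smoothCharts n X) (hx : x ∈ χ.source) (a b c : Fin n) :
    christoffel (G.scale r hr) χ a b c x = christoffel G χ a b c x := by
  simp only [christoffel, gramInv_scale G hr hχ hx, gram_scale, pd_const_mul]
  congr 1
  refine Finset.sum_congr rfl fun d _ => ?_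
  field_simp [hr.ne']

lemma laplacian_scale (hχ : χ ∈ smoothCharts n X) (hx : x ∈ χ.source) (f : X → ℝ) :
    laplacian (G.scale r hr) χ (fun y => r * f y) x = laplacian G χ f x := by
  simp only [laplacian, gramInv_scale G hr hχ hx, christoffel_scale G hr hχ hx, pd_const_mul]
  refine Finset.sum_congr rfl fun a _ => Finset.sum_congr rfl fun b _ => ?_
  have h : ∑ d, christoffel G χ d a b x * (r * pd χ d f x)
      = r * ∑ d, christoffel G χ d a b x * pd χ d f x := by
    rw [Finset.mul_sum]
    exact Finset.sum_congr rfl fun d _ => by ring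
  rw [h, ← mul_sub]
  field_simp [hr.ne']

end ScaleMetric

lemma nabla_const_mul (r : ℝ) (u : S → Fin D → ℝ) (α : Fin 2) (i : Fin D) (x : S) :
    nabla b φ χ (fun y i => r * u y i) α i x = r * nabla b φ χ u α i x := by
  simp only [nabla, pd_const_mul, mul_add, Finset.mul_sum]
  congr 1
  exact Finset.sum_congr rfl fun l _ => Finset.sum_congr rfl fun k _ => by ring

lemma nabla2_const_mul (r : ℝ) (u : S → Fin D → ℝ) (α β : Fin 2) (i : Fin D) (x : S) :
    nabla2 b φ χ (fun y i => r * u y i) α β i x = r * nabla2 b φ χ u α β i x := by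
  simp only [nabla2, nabla_const_mul, pd_const_mul, mul_add, mul_sub, Finset.mul_sum]
  congr 1
  · congr 1
    exact Finset.sum_congr rfl fun l _ => by ring
  · exact Finset.sum_congr rfl fun l _ => Finset.sum_congr rfl fun k _ => by ring

variable {lam : ℝ} (hlam : 0 < lam)

lemma nabla2_scale (hφ : φ ∈ smoothCharts 2 S) {x : S} (hx : x ∈ φ.source) (u : S → Fin D → ℝ)
    (α β : Fin 2) (i : Fin D) :
    nabla2 (b.scale lam hlam) φ χ u α β i x = nabla2 b φ χ u α β i x := by
  have h1 := fun δ => christoffel_scale b.γ (zpow_pos hlam (-2)) hφ hx δ α β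
  have h2 : ∀ α i x, nabla (b.scale lam hlam) φ χ u α i x = nabla b φ χ u α i x :=
    fun _ _ _ => rfl
  have h3 : ∀ l α x, dpsi (b.scale lam hlam) φ χ l α x = dpsi b φ χ l α x := fun _ _ _ => rfl
  have h4 : (b.scale lam hlam).γ = b.γ.scale (lam ^ (-2 : ℤ)) (zpow_pos hlam _) := rfl
  have h5 : (b.scale lam hlam).g = b.g := rfl
  have h6 : (b.scale lam hlam).ψ = b.ψ := rfl
  simp only [nabla2, h2, h3, h4, h5, h6, h1]

lemma zpow_neg_two_inv (lam : ℝ) : (lam ^ (-2 : ℤ))⁻¹ = lam ^ 2 := by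
  rw [zpow_neg, inv_inv]
  norm_cast

lemma opE_scale (hφ : φ ∈ smoothCharts 2 S) {x : S} (hx : x ∈ φ.source) (r : ℝ)
    (u : S → Fin D → ℝ) (a : Fin D) :
    opE (b.scale lam hlam) φ χ (fun y i => r * u y i) a x
      = lam ^ 2 * r * opE b φ χ u a x := by
  have h1 := fun α β => gramInv_scale b.γ (zpow_pos hlam (-2)) hφ hx α β
  have h4 : (b.scale lam hlam).γ = b.γ.scale (lam ^ (-2 : ℤ)) (zpow_pos hlam _) := rfl
  have h5 : (b.scale lam hlam).g = b.g := rfl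
  have h6 : (b.scale lam hlam).ψ = b.ψ := rfl
  simp only [opE, nabla2_scale hlam hφ hx, nabla2_const_mul, h4, h5, h6, h1, zpow_neg_two_inv,
    Finset.mul_sum]
  exact Finset.sum_congr rfl fun i _ => Finset.sum_congr rfl fun α _ =>
    Finset.sum_congr rfl fun β _ => by ring

lemma sigma_scale (x x' : S) :
    (b.scale lam hlam).γ.sigma x x' = lam ^ (-2 : ℤ) * b.γ.sigma x x' :=
  b.γ.sigma_scale (zpow_pos hlam _) x x'

lemma nablaAlong_scale (hφ : φ ∈ smoothCharts 2 S) {x : S} (hx : x ∈ φ.source) (r : ℝ)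
    (u : S → Fin D → ℝ) (x' : S) (a : Fin D) :
    nablaAlong (b.scale lam hlam) φ χ (fun y i => r * u y i)
        (fun z => (b.scale lam hlam).γ.sigma z x') a x
      = r * nablaAlong b φ χ u (fun z => b.γ.sigma z x') a x := by
  have h1 := fun α β => gramInv_scale b.γ (zpow_pos hlam (-2)) hφ hx α β
  have h2 : ∀ (u : S → Fin D → ℝ) α i x,
      nabla (b.scale lam hlam) φ χ u α i x = nabla b φ χ u α i x := fun _ _ _ _ => rfl
  have h5 : (b.scale lam hlam).g = b.g := rfl
  have h6 : (b.scale lam hlam).ψ = b.ψ := rfl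
  simp only [nablaAlong, sigma_scale, h2, nabla_const_mul, pd_const_mul, h5, h6]
  have h4 : (b.scale lam hlam).γ = b.γ.scale (lam ^ (-2 : ℤ)) (zpow_pos hlam _) := rfl
  simp only [h4, h1, Finset.mul_sum]
  have h0 : lam ^ (-2 : ℤ) ≠ 0 := (zpow_pos hlam _).ne'
  refine Finset.sum_congr rfl fun i _ => Finset.sum_congr rfl fun α _ =>
    Finset.sum_congr rfl fun β _ => ?_
  field_simp

lemma laplacian_sigma_scale (hφ : φ ∈ smoothCharts 2 S) {x : S} (hx : x ∈ φ.source) (x' : S) :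
    laplacian (b.scale lam hlam).γ φ (fun z => (b.scale lam hlam).γ.sigma z x') x
      = laplacian b.γ φ (fun z => b.γ.sigma z x') x := by
  simp only [sigma_scale]
  exact laplacian_scale b.γ (zpow_pos hlam (-2)) hφ hx _

lemma SmoothBitensorOn.const_smul {ψ : S → M} {T : Bitensor D ψ} (hT : SmoothBitensorOn O T)
    (r : ℝ) : SmoothBitensorOn O fun x x' => r • T x x' := by
  intro χ hχ χ' hχ' i j
  simp only [comp_smul]
  exact contMDiffOn_const.mul (hT χ hχ χ' hχ' i j)

lemma SmoothBitensorOn.add {ψ : S → M} {T U : Bitensor D ψ} (hT : SmoothBitensorOn O T)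
    (hU : SmoothBitensorOn O U) : SmoothBitensorOn O fun x x' => T x x' + U x x' := by
  intro χ hχ χ' hχ' i j
  simp only [comp_add]
  exact (hT χ hχ χ' hχ' i j).add (hU χ hχ χ' hχ' i j)

lemma transport_zero_scale (hφ : φ ∈ smoothCharts 2 S) {x : S} (hx : x ∈ φ.source)
    (T : Bitensor D b.ψ) (r : ℝ) (x' : S) (a j : Fin D) :
    2 * nablaAlong (b.scale lam hlam) φ χ (fun y i => comp χ χ' (r • T y x') i j)
          (fun y => (b.scale lam hlam).γ.sigma y x') a x
        + (∑ i, gram b.g χ (b.ψ x) a i * comp χ χ' (r • T x x') i j)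
          * (laplacian (b.scale lam hlam).γ φ (fun y => (b.scale lam hlam).γ.sigma y x') x - 2)
      = r * (2 * nablaAlong b φ χ (fun y i => comp χ χ' (T y x') i j)
          (fun y => b.γ.sigma y x') a x
        + (∑ i, gram b.g χ (b.ψ x) a i * comp χ χ' (T x x') i j)
          * (laplacian b.γ φ (fun y => b.γ.sigma y x') x - 2)) := by
  have hgram : ∑ i, gram b.g χ (b.ψ x) a i * (r * comp χ χ' (T x x') i j)
      = r * ∑ i, gram b.g χ (b.ψ x) a i * comp χ χ' (T x x') i j := by
    rw [Finset.mul_sum]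
    exact Finset.sum_congr rfl fun i _ => by ring
  simp only [comp_smul, nablaAlong_scale hlam hφ hx, laplacian_sigma_scale hlam hφ hx, hgram]
  ring

lemma transport_pos_scale (hφ : φ ∈ smoothCharts 2 S) {x : S} (hx : x ∈ φ.source)
    (T U : Bitensor D b.ψ) (r : ℝ) (x' : S) (a j : Fin D) (n : ℕ) :
    opE (b.scale lam hlam) φ χ (fun y i => comp χ χ' (r • U y x') i j) a x
        + 2 * (n : ℝ) * nablaAlong (b.scale lam hlam) φ χ
          (fun y i => comp χ χ' ((lam ^ 2 * r) • T y x') i j)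
          (fun y => (b.scale lam hlam).γ.sigma y x') a x
        + (n : ℝ) * (∑ i, gram b.g χ (b.ψ x) a i * comp χ χ' ((lam ^ 2 * r) • T x x') i j)
          * (laplacian (b.scale lam hlam).γ φ (fun y => (b.scale lam hlam).γ.sigma y x') x
            + 2 * ((n : ℝ) - 1))
      = lam ^ 2 * r * (opE b φ χ (fun y i => comp χ χ' (U y x') i j) a x
        + 2 * (n : ℝ) * nablaAlong b φ χ (fun y i => comp χ χ' (T y x') i j)
          (fun y => b.γ.sigma y x') a x
        + (n : ℝ) * (∑ i, gram b.g χ (b.ψ x) a i * comp χ χ' (T x x') i j)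
          * (laplacian b.γ φ (fun y => b.γ.sigma y x') x + 2 * ((n : ℝ) - 1))) := by
  have hgram : ∑ i, gram b.g χ (b.ψ x) a i * (lam ^ 2 * r * comp χ χ' (T x x') i j)
      = lam ^ 2 * r * ∑ i, gram b.g χ (b.ψ x) a i * comp χ χ' (T x x') i j := by
    rw [Finset.mul_sum]
    exact Finset.sum_congr rfl fun i _ => by ring
  simp only [comp_smul, nablaAlong_scale hlam hφ hx, laplacian_sigma_scale hlam hφ hx, hgram,
    opE_scale hlam hφ hx]
  ring

/-- The transport equations of the rescaled background for `λ^(2n) V_n` are `λ^(2n)` times those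
of the original background for `V_n`. -/
theorem isHadamardSeq_scale_iff :
    IsHadamardSeq (b.scale lam hlam) O (fun n x x' => lam ^ (2 * n) • V n x x')
      ↔ IsHadamardSeq b O V := by
  have hpos : ∀ n : ℕ, lam ^ (2 * n) ≠ 0 := fun n => pow_ne_zero _ hlam.ne'
  have hsucc : ∀ m : ℕ, lam ^ (2 * (m + 1)) = lam ^ 2 * lam ^ (2 * m) := fun m => by ring
  constructor
  · intro h
    refine ⟨fun n => ?_, fun x hx => ?_, ?_, ?_⟩
    · have h1 : SmoothBitensorOn O fun x x' => lam ^ (2 * n) • V n x x' := h.smooth n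
      have h2 := h1.const_smul (lam ^ (2 * n))⁻¹
      simpa only [smul_smul, inv_mul_cancel₀ (hpos n), one_smul] using h2
    · have h1 : lam ^ (2 * 0) • V 0 x x = inverseMetric b.g (b.ψ x) := h.init x hx
      rwa [mul_zero, pow_zero, one_smul] at h1
    · intro φ hφ χ hχ χ' hχ' x hx x' hx' hxs hψ hψ' a j
      have h1 := h.transport_zero φ hφ χ hχ χ' hχ' x hx x' hx' hxs hψ hψ' a j
      exact (mul_eq_zero.1 ((transport_zero_scale hlam hφ hxs (V 0) (lam ^ (2 * 0)) x' a
        j).symm.trans h1)).resolve_left (hpos 0)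
    · intro n hn φ hφ χ hχ χ' hχ' x hx x' hx' hxs hψ hψ' a j
      have h1 := h.transport_pos n hn φ hφ χ hχ χ' hχ' x hx x' hx' hxs hψ hψ' a j
      obtain ⟨m, rfl⟩ : ∃ m, n = m + 1 := ⟨n - 1, by omega⟩
      simp only [Nat.add_sub_cancel, hsucc] at h1 ⊢
      refine (mul_eq_zero.1 ((transport_pos_scale hlam hφ hxs (V (m + 1)) (V m) (lam ^ (2 * m)) x' a
        j (m + 1)).symm.trans h1)).resolve_left ?_
      rw [← hsucc]
      exact hpos _
  · intro h
    refine ⟨fun n => (h.smooth n).const_smul _, fun x hx => ?_, ?_, ?_⟩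
    · simp only [mul_zero, pow_zero, one_smul]
      exact h.init x hx
    · intro φ hφ χ hχ χ' hχ' x hx x' hx' hxs hψ hψ' a j
      refine (transport_zero_scale hlam hφ hxs (V 0) (lam ^ (2 * 0)) x' a j).trans ?_
      rw [h.transport_zero φ hφ χ hχ χ' hχ' x hx x' hx' hxs hψ hψ' a j, mul_zero]
    · intro n hn φ hφ χ hχ χ' hχ' x hx x' hx' hxs hψ hψ' a j
      have h1 := h.transport_pos n hn φ hφ χ hχ χ' hχ' x hx x' hx' hxs hψ hψ' a j
      obtain ⟨m, rfl⟩ : ∃ m, n = m + 1 := ⟨n - 1, by omega⟩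
      simp only [Nat.add_sub_cancel, hsucc] at h1 ⊢
      refine (transport_pos_scale hlam hφ hxs (V (m + 1)) (V m) (lam ^ (2 * m)) x' a j
        (m + 1)).trans ?_
      rw [h1, mul_zero]

/-- The Hadamard coefficients of the rescaled background are `λ^(2n) V_n`. -/
theorem IsHadamardSeq.eq_of_scale (hO : IsConvexGeodesic b.γ O) (hV : IsHadamardSeq b O V)
    {V' : ℕ → Bitensor D b.ψ} (hV' : IsHadamardSeq (b.scale lam hlam) O V') (n : ℕ) :
    ∀ x ∈ O, ∀ x' ∈ O, V' n x x' = lam ^ (2 * n) • V n x x' := by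
  have hpos : ∀ n : ℕ, lam ^ (2 * n) ≠ 0 := fun n => pow_ne_zero _ hlam.ne'
  have h : IsHadamardSeq b O fun n x x' => (lam ^ (2 * n))⁻¹ • V' n x x' := by
    rw [← isHadamardSeq_scale_iff hlam]
    simp only [smul_smul, mul_inv_cancel₀ (hpos _), one_smul]
    exact hV'
  intro x hx x' hx'
  rw [hV.unique hO h n x hx x' hx', smul_smul, mul_inv_cancel₀ (hpos n), one_smul]

end Coefficients

/-! ### Expansions at the diagonal -/

section Diagonal

variable {D : ℕ}
  {S : Type*} [TopologicalSpace S] [ChartedSpace (Eu 2) S] [IsManifold (𝓡 2) ∞ S]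
  {M : Type*} [TopologicalSpace M] [ChartedSpace (Eu D) M] [IsManifold (𝓡 D) ∞ M]
  {γ : Metric 2 S} {ψ : S → M} {O : Set S} {A : Set (S × S)} {T U : Bitensor D ψ} {N : ℕ}

lemma eventually_mem_prod (hO : IsOpen O) {x₀ : S} (hx₀ : x₀ ∈ O) :
    ∀ᶠ p in 𝓝[A] (x₀, x₀), p ∈ O ×ˢ O ∧ p ∈ A := by
  have h : O ×ˢ O ∈ 𝓝 (x₀, x₀) := (hO.prod hO).mem_nhds ⟨hx₀, hx₀⟩
  filter_upwards [nhdsWithin_le_nhds h, self_mem_nhdsWithin] with p hp hpA using ⟨hp, hpA⟩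

lemma BigOSigma.congr (hO : IsOpen O) (hT : BigOSigma γ O A T N)
    (h : ∀ x ∈ O, ∀ x' ∈ O, (x, x') ∈ A → T x x' = U x x') : BigOSigma γ O A U N := by
  intro x₀ hx₀ χ hχ χ' hχ' h1 h2 i j
  refine (hT x₀ hx₀ χ hχ χ' hχ' h1 h2 i j).congr' ?_ EventuallyEq.rfl
  filter_upwards [eventually_mem_prod hO hx₀] with p hp
  rw [h p.1 hp.1.1 p.2 hp.1.2 hp.2]

lemma BigOSigma.sub (hT : BigOSigma γ O A T N) (hU : BigOSigma γ O A U N) :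
    BigOSigma γ O A (fun x x' => T x x' - U x x') N := by
  intro x₀ hx₀ χ hχ χ' hχ' h1 h2 i j
  simp only [comp_sub]
  exact (hT x₀ hx₀ χ hχ χ' hχ' h1 h2 i j).sub (hU x₀ hx₀ χ hχ χ' hχ' h1 h2 i j)

lemma BigOSigma.mono {B : Set (S × S)} (hT : BigOSigma γ O A T N) (hB : B ⊆ A) :
    BigOSigma γ O B T N := fun x₀ hx₀ χ hχ χ' hχ' h1 h2 i j =>
  (hT x₀ hx₀ χ hχ χ' hχ' h1 h2 i j).mono (nhdsWithin_mono _ hB)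

lemma bigOSigma_scale_iff {r : ℝ} (hr : 0 < r) :
    BigOSigma (γ.scale r hr) O A T N ↔ BigOSigma γ O A T N := by
  have h : ∀ x₀ : S, ∀ f : S × S → ℝ,
      (f =O[𝓝[A] (x₀, x₀)] fun p => (γ.scale r hr).sigma p.1 p.2 ^ N)
        ↔ f =O[𝓝[A] (x₀, x₀)] fun p => γ.sigma p.1 p.2 ^ N := by
    intro x₀ f
    simp only [γ.sigma_scale hr, mul_pow]
    exact Asymptotics.isBigO_const_mul_right_iff (pow_ne_zero N hr.ne')
  simp only [BigOSigma, h]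

/-- A bitensor that is `O(σ)` near the diagonal, the diagonal included, vanishes on it. -/
lemma BigOSigma.apply_self (hT : BigOSigma γ O univ T 1) {x : S} (hx : x ∈ O) : T x x = 0 := by
  have hχ : chartAt (Eu D) (ψ x) ∈ smoothCharts D M := IsManifold.chart_mem_maximalAtlas _
  refine eq_of_comp_eq hχ (mem_chart_source _ _) hχ (mem_chart_source _ _) fun i j => ?_
  obtain ⟨C, hC⟩ :=
    (hT x hx _ hχ _ hχ (mem_chart_source _ _) (mem_chart_source _ _) i j).bound
  rw [nhdsWithin_univ] at hC
  have h1 := hC.self_of_nhds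
  simp only [γ.sigma_self, pow_one, norm_zero, mul_zero, norm_le_zero_iff] at h1
  rw [h1]
  simp [comp]

/-- The logarithm costs at most one power of `σ`. -/
lemma BigOSigma.log_smul (hO : IsConvexGeodesic γ O) (hT : BigOSigma γ O A T (N + 1)) {a : ℝ}
    (ha : 0 < a) :
    BigOSigma γ O A (fun x x' => Real.log (γ.sigma x x' * a) • T x x') N := by
  intro x₀ hx₀ χ hχ χ' hχ' h1 h2 i j
  simp only [comp_smul]
  have hlog : (fun p : S × S => Real.log (γ.sigma p.1 p.2 * a) * γ.sigma p.1 p.2)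
      =O[𝓝[A] (x₀, x₀)] fun _ => (1 : ℝ) := by
    have h3 : Tendsto (fun p : S × S => γ.sigma p.1 p.2 * a) (𝓝[A] (x₀, x₀)) (𝓝 (0 * a)) :=
      ((hO.tendsto_sigma hx₀).mono_left nhdsWithin_le_nhds).mul_const a
    have h4 := (Real.continuous_mul_log.tendsto _).comp h3
    have h5 : (fun p : S × S => Real.log (γ.sigma p.1 p.2 * a) * γ.sigma p.1 p.2)
        = fun p => a⁻¹ * ((fun x => x * Real.log x) ∘ fun p : S × S => γ.sigma p.1 p.2 * a) p := by
      funext p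
      simp only [Function.comp_apply]
      field_simp
    rw [h5]
    exact (h4.const_mul a⁻¹).isBigO_one ℝ
  have h6 := (Asymptotics.isBigO_refl (fun p : S × S => Real.log (γ.sigma p.1 p.2 * a))
    (𝓝[A] (x₀, x₀))).mul (hT x₀ hx₀ χ hχ χ' hχ' h1 h2 i j)
  refine h6.trans ?_
  have h7 := hlog.mul (Asymptotics.isBigO_refl (fun p : S × S => γ.sigma p.1 p.2 ^ N)
    (𝓝[A] (x₀, x₀)))
  simp only [one_mul] at h7
  refine h7.congr_left fun p => ?_
  rw [pow_succ]
  ring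

lemma neBot_nhdsWithin_offDiag (x₀ : S) : (𝓝[{p : S × S | p.1 ≠ p.2}] (x₀, x₀)).NeBot := by
  set φ := chartAt (Eu 2) x₀
  have hx : x₀ ∈ φ.source := mem_chart_source _ _
  have hne : (𝓝[≠] (φ x₀)).NeBot := Module.punctured_nhds_neBot ℝ (Eu 2) (φ x₀)
  have h1 : Tendsto (fun u => (φ.symm u, x₀)) (𝓝[≠] (φ x₀))
      (𝓝[{p : S × S | p.1 ≠ p.2}] (x₀, x₀)) := by
    refine tendsto_nhdsWithin_iff.2 ⟨?_, ?_⟩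
    · have h2 := (φ.continuousAt_symm (φ.map_source hx)).tendsto
      rw [φ.left_inv hx] at h2
      exact (h2.prodMk_nhds tendsto_const_nhds).mono_left nhdsWithin_le_nhds
    · have h3 : ∀ᶠ u in 𝓝[≠] (φ x₀), u ∈ φ.target :=
        nhdsWithin_le_nhds (φ.open_target.mem_nhds (φ.map_source hx))
      filter_upwards [h3, self_mem_nhdsWithin] with u hu hu' heq
      refine hu' ?_
      have h4 : φ.symm u = x₀ := heq
      rw [mem_singleton_iff, ← h4, φ.right_inv hu]
  exact h1.neBot

/-- A smooth bitensor that is `O(σ)` off the diagonal vanishes on the diagonal. -/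
lemma SmoothBitensorOn.apply_self_eq_zero (hO : IsConvexGeodesic γ O) (hψ : Continuous ψ)
    (hT : SmoothBitensorOn O T) (hT' : BigOSigma γ O {p | p.1 ≠ p.2} T 1) {x : S} (hx : x ∈ O) :
    T x x = 0 := by
  have hχ : chartAt (Eu D) (ψ x) ∈ smoothCharts D M := IsManifold.chart_mem_maximalAtlas _
  have hs : ψ x ∈ (chartAt (Eu D) (ψ x)).source := mem_chart_source _ _
  refine eq_of_comp_eq hχ hs hχ hs fun i j => ?_
  have := neBot_nhdsWithin_offDiag x
  have h1 := (hT.contMDiffAt hO.1 hψ hχ hχ hx hx hs hs i j).continuousAt.tendsto.mono_left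
    (nhdsWithin_le_nhds (s := {p : S × S | p.1 ≠ p.2}))
  have h2 := (hO.tendsto_sigma hx).mono_left
    (nhdsWithin_le_nhds (s := {p : S × S | p.1 ≠ p.2}))
  have h3 := hT' x hx _ hχ _ hχ hs hs i j
  simp only [pow_one] at h3
  rw [tendsto_nhds_unique h1 (h3.trans_tendsto h2)]
  simp [comp]

lemma IsHadamardSum.apply_self {Vn : ℕ → Bitensor D ψ} {V : Bitensor D ψ}
    (hV : IsHadamardSum γ O Vn V) {x : S} (hx : x ∈ O) : V x x = Vn 0 x x := by
  have h := (hV.expansion 1).apply_self hx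
  simpa [partialSum, sub_eq_zero] using h

end Diagonal

/-! ### Parametrices of the rescaled background -/

section Parametrix

variable {D : ℕ}
  {S : Type*} [TopologicalSpace S] [ChartedSpace (Eu 2) S] [IsManifold (𝓡 2) ∞ S]
  {M : Type*} [TopologicalSpace M] [ChartedSpace (Eu D) M] [IsManifold (𝓡 D) ∞ M]
  {b : Background D S M} {O : Set S} {lam : ℝ} (hlam : 0 < lam)

lemma partialSum_scale {Vn Vn' : ℕ → Bitensor D b.ψ} {x x' : S}
    (h : ∀ n, Vn' n x x' = lam ^ (2 * n) • Vn n x x') (N : ℕ) :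
    partialSum (b.scale lam hlam).γ Vn' N x x' = partialSum b.γ Vn N x x' := by
  unfold partialSum
  refine Finset.sum_congr rfl fun n _ => ?_
  have h1 : (lam ^ (-2 : ℤ)) ^ n * lam ^ (2 * n) = 1 := by
    rw [pow_mul, ← mul_pow, ← zpow_neg_two_inv, mul_inv_cancel₀ (zpow_pos hlam _).ne', one_pow]
  rw [h, smul_smul, sigma_scale, mul_pow, mul_right_comm, h1, one_mul]

lemma log_sigma_scale {l : ℝ} (hl : 0 < l) {x x' : S} (hσ : 0 < b.γ.sigma x x') :
    Real.log ((b.scale lam hlam).γ.sigma x x' / l ^ 2)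
      = -2 * Real.log lam + Real.log (b.γ.sigma x x' / l ^ 2) := by
  rw [sigma_scale, mul_div_assoc, Real.log_mul (zpow_pos hlam _).ne' (by positivity),
    Real.log_zpow]
  norm_num

lemma logKernel_scale_sub {l : ℝ} (hl : 0 < l) (V : Bitensor D b.ψ) {x x' : S}
    (hσ : 0 < b.γ.sigma x x') :
    logKernel (b.scale lam hlam).γ l V x x' - logKernel b.γ l V x x'
      = (-2 * Real.log lam) • V x x' := by
  simp only [logKernel]
  rw [log_sigma_scale hlam hl hσ, ← sub_smul, add_sub_cancel_right]

lemma IsHadamardSum.scale (hO : IsOpen O) {Vn Vn' : ℕ → Bitensor D b.ψ} {V : Bitensor D b.ψ}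
    (h : ∀ n, ∀ x ∈ O, ∀ x' ∈ O, Vn' n x x' = lam ^ (2 * n) • Vn n x x')
    (hV : IsHadamardSum b.γ O Vn V) : IsHadamardSum (b.scale lam hlam).γ O Vn' V := by
  refine ⟨hV.smooth, fun N => ?_⟩
  refine (bigOSigma_scale_iff (zpow_pos hlam (-2))).2 ?_
  refine (hV.expansion N).congr hO fun x hx x' hx' _ => ?_
  rw [partialSum_scale hlam fun n => h n x hx x' hx']

/-- For two sums of the same series the parametrices of the two backgrounds differ by
`-2 log(λ) V` up to a remainder vanishing to infinite order at the diagonal. -/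
lemma bigOSigma_logKernel_scale_sub [T2Space S] (hO : IsConvexGeodesic b.γ O) {l : ℝ} (hl : 0 < l)
    {Vn : ℕ → Bitensor D b.ψ} {V V' : Bitensor D b.ψ}
    (hV : IsHadamardSum (b.scale lam hlam).γ O Vn V)
    (hV' : IsHadamardSum (b.scale lam hlam).γ O Vn V') (N : ℕ) :
    BigOSigma b.γ O {p | p.1 ≠ p.2}
      (fun x x' => logKernel (b.scale lam hlam).γ l V' x x' - logKernel b.γ l V x x'
        + (2 * Real.log lam) • V x x') N := by
  have h1 : BigOSigma (b.scale lam hlam).γ O univ (fun x x' => V' x x' - V x x') (N + 1) :=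
    ((hV'.expansion (N + 1)).sub (hV.expansion (N + 1))).congr hO.1 fun x _ x' _ _ => by abel
  have h2 : BigOSigma b.γ O {p | p.1 ≠ p.2} (fun x x' => V' x x' - V x x') (N + 1) :=
    ((bigOSigma_scale_iff (zpow_pos hlam (-2))).1 h1).mono (subset_univ _)
  have ha : 0 < lam ^ (-2 : ℤ) / l ^ 2 := div_pos (zpow_pos hlam _) (by positivity)
  refine (h2.log_smul hO ha).congr hO.1 fun x hx x' hx' hne => ?_
  have h3 := logKernel_scale_sub hlam hl V (hO.sigma_pos hx hx' hne)
  have h4 : b.γ.sigma x x' * (lam ^ (-2 : ℤ) / l ^ 2)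
      = (b.scale lam hlam).γ.sigma x x' / l ^ 2 := by
    rw [sigma_scale]
    ring
  have h5 : Real.log ((b.scale lam hlam).γ.sigma x x' / l ^ 2) • (V' x x' - V x x')
      = logKernel (b.scale lam hlam).γ l V' x x' - logKernel (b.scale lam hlam).γ l V x x' :=
    smul_sub _ _ _
  rw [h4, h5, eq_add_of_sub_eq h3]
  module

end Parametrix

end HadamardScaling

end

open HadamardScaling in
theorem mainTheorem7 {D : ℕ}
    {S : Type*} [TopologicalSpace S] [ChartedSpace (Eu 2) S] [IsManifold (𝓡 2) ∞ S]
    [T2Space S] [SecondCountableTopology S] [ConnectedSpace S]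
    {M : Type*} [TopologicalSpace M] [ChartedSpace (Eu D) M] [IsManifold (𝓡 D) ∞ M]
    [T2Space M] [SecondCountableTopology M] [ConnectedSpace M]
    (b : Background D S M) (lam : ℝ) (hlam : 0 < lam) (l : ℝ) (hl : 0 < l)
    (O : Set S) (hO : IsConvexGeodesic b.γ O)
    (Vn : ℕ → Bitensor D b.ψ) (hVn : IsHadamardSeq b O Vn) :
    -- the rescaled background has Hadamard coefficients on `O`, namely `λ^(2n) V_n` ...
    IsHadamardSeq (b.scale lam hlam) O (fun n x x' => lam ^ (2 * n) • Vn n x x') ∧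
    ∀ Vn' : ℕ → Bitensor D b.ψ, IsHadamardSeq (b.scale lam hlam) O Vn' →
      -- ... and only these
      (∀ n, ∀ x ∈ O, ∀ x' ∈ O, Vn' n x x' = lam ^ (2 * n) • Vn n x x') ∧
      -- the formal series: `H_λ - H = -2 log(λ) V` at every order of truncation
      (∀ N, ∀ x ∈ O, ∀ x' ∈ O, x ≠ x' →
        logKernel (b.scale lam hlam).γ l (partialSum (b.scale lam hlam).γ Vn' N) x x'
          - logKernel b.γ l (partialSum b.γ Vn N) x x'
          = (-2 * Real.log lam) • partialSum b.γ Vn N x x') ∧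
      ∀ V : Bitensor D b.ψ, IsHadamardSum b.γ O Vn V →
        -- the coinciding point limit of `V`
        (∀ x ∈ O, V x x = inverseMetric b.g (b.ψ x)) ∧
        -- `V` also sums the series of the rescaled background, and with this common choice
        -- `H_λ - H = -2 log(λ) V`
        IsHadamardSum (b.scale lam hlam).γ O Vn' V ∧
        (∀ x ∈ O, ∀ x' ∈ O, x ≠ x' →
          logKernel (b.scale lam hlam).γ l V x x' - logKernel b.γ l V x x'
            = (-2 * Real.log lam) • V x x') ∧
        -- the remainder of a kernel `P = H + W` with respect to `H_λ` is `W + 2 log(λ) V`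
        (∀ P W : Bitensor D b.ψ, SmoothBitensorOn O W →
          (∀ x ∈ O, ∀ x' ∈ O, x ≠ x' → P x x' = logKernel b.γ l V x x' + W x x') →
          ∃ W' : Bitensor D b.ψ, SmoothBitensorOn O W' ∧
            (∀ x ∈ O, ∀ x' ∈ O, x ≠ x' →
              P x x' = logKernel (b.scale lam hlam).γ l V x x' + W' x x') ∧
            (∀ x ∈ O, ∀ x' ∈ O, W' x x' = W x x' + (2 * Real.log lam) • V x x') ∧
            (SymmBitensorOn O V → SymmBitensorOn O W → SymmBitensorOn O W')) ∧
        -- for an arbitrary sum `V'` of the series of the rescaled background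
        ∀ V' : Bitensor D b.ψ, IsHadamardSum (b.scale lam hlam).γ O Vn' V' →
          (∀ x ∈ O, V' x x = inverseMetric b.g (b.ψ x)) ∧
          -- `H_λ - H = -2 log(λ) V` up to terms vanishing to infinite order at the diagonal
          (∀ N, BigOSigma b.γ O {p | p.1 ≠ p.2}
            (fun x x' => logKernel (b.scale lam hlam).γ l V' x x' - logKernel b.γ l V x x'
              + (2 * Real.log lam) • V x x') N) ∧
          -- the shift of the coinciding point limit of the smooth remainder
          (∀ P W W' : Bitensor D b.ψ, SmoothBitensorOn O W → SmoothBitensorOn O W' →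
            (∀ x ∈ O, ∀ x' ∈ O, x ≠ x' → P x x' = logKernel b.γ l V x x' + W x x') →
            (∀ x ∈ O, ∀ x' ∈ O, x ≠ x' →
              P x x' = logKernel (b.scale lam hlam).γ l V' x x' + W' x x') →
            ∀ x ∈ O, W' x x = W x x + (2 * Real.log lam) • inverseMetric b.g (b.ψ x)) := by
  have hcoef : ∀ Vn' : ℕ → Bitensor D b.ψ, IsHadamardSeq (b.scale lam hlam) O Vn' →
      ∀ n, ∀ x ∈ O, ∀ x' ∈ O, Vn' n x x' = lam ^ (2 * n) • Vn n x x' :=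
    fun Vn' hVn' n => hVn.eq_of_scale hlam hO hVn' n
  refine ⟨(isHadamardSeq_scale_iff hlam).2 hVn, fun Vn' hVn' => ⟨hcoef Vn' hVn', ?_, ?_⟩⟩
  · intro N x hx x' hx' hne
    have h1 : logKernel (b.scale lam hlam).γ l (partialSum (b.scale lam hlam).γ Vn' N) x x'
        = logKernel (b.scale lam hlam).γ l (partialSum b.γ Vn N) x x' := by
      simp only [logKernel]
      rw [partialSum_scale hlam fun n => hcoef Vn' hVn' n x hx x' hx']
    rw [h1]
    exact logKernel_scale_sub hlam hl _ (hO.sigma_pos hx hx' hne)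
  · intro V hV
    have hV₁ : IsHadamardSum (b.scale lam hlam).γ O Vn' V := hV.scale hlam hO.1 (hcoef Vn' hVn')
    have hdiag : ∀ x ∈ O, V x x = inverseMetric b.g (b.ψ x) := fun x hx => by
      rw [hV.apply_self hx, hVn.init x hx]
    refine ⟨hdiag, hV₁, fun x hx x' hx' hne =>
      logKernel_scale_sub hlam hl V (hO.sigma_pos hx hx' hne), ?_, ?_⟩
    · intro P W hW hP
      refine ⟨fun x x' => W x x' + (2 * Real.log lam) • V x x', hW.add (hV.smooth.const_smul _),
        fun x hx x' hx' hne => ?_, fun x _ x' _ => rfl, fun hsV hsW x hx x' hx' => ?_⟩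
      · have h3 := logKernel_scale_sub hlam hl V (hO.sigma_pos hx hx' hne)
        rw [hP x hx x' hx' hne, eq_add_of_sub_eq h3]
        module
      · rw [map_add, map_smul, hsV x hx x' hx', hsW x hx x' hx']
    · intro V' hV'
      have hlog := bigOSigma_logKernel_scale_sub hlam hO hl hV₁ hV'
      refine ⟨fun x hx => ?_, hlog, ?_⟩
      · rw [hV'.apply_self hx]
        exact hVn'.init x hx
      · intro P W W' hW hW' hP hP' x hx
        -- the expected difference of the remainders is the difference of the parametrices, so
        -- it is `O(σ)` off the diagonal
        have hsm : SmoothBitensorOn O fun x x' =>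
            (W x x' + (2 * Real.log lam) • V x x') + (-1 : ℝ) • W' x x' :=
          (hW.add (hV.smooth.const_smul _)).add (hW'.const_smul _)
        have hbig : BigOSigma b.γ O {p | p.1 ≠ p.2} (fun x x' =>
            (W x x' + (2 * Real.log lam) • V x x') + (-1 : ℝ) • W' x x') 1 := by
          refine (hlog 1).congr hO.1 fun x hx x' hx' hne => ?_
          have h1 := (hP x hx x' hx' hne).symm.trans (hP' x hx x' hx' hne)
          have h2 : W' x x' = logKernel b.γ l V x x' + W x x'
              - logKernel (b.scale lam hlam).γ l V' x x' := by
            rw [h1]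
            abel
          rw [h2]
          module
        have h0 := hsm.apply_self_eq_zero hO b.continuous_ψ hbig hx
        rw [neg_one_smul, ← sub_eq_add_neg, sub_eq_zero] at h0
        rw [← hdiag x hx, h0]
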